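/- **Setting.** Let $r:\mathbb R^n\to\mathbb R^m$ ($n\ge 1$), $f(x)=\|r(x)\|^2$, $p\ge n$, and let all norms be Euclidean/spectral, $B(x,\Delta)$ the closed ball. For a set $Y=\{y_0,\dots,y_p\}\ni x$, a regression model at $x$ is $m(s)=\|\hat r+\hat Js\|^2$, where $(\hat r,\hat J)$ minimizes $\sum_t\|\hat r+\hat J(y_t-x)-r(y_t)\|^2$; put $g=2\hat J^\top\hat r$, $H=2\hat J^\top\hat J$. $Y$ is *$\Lambda$-poised in $B(x,\Delta)$* if $Y\subset B(x,\Delta)$, the matrix with rows $(1,(y_t-x)^\top)$ has full column rank, and the regression Lagrange polynomials $\Lambda_t$ (the affine functions minimizing $\sum_s(\Lambda_t(y_s)-\delta_{st})^2$) satisfy $|\Lambda_t|\le\Lambda$ on $B(x,\Delta)$. $\hat W$ denotes the matrix with rows $(1,(y_t-x)^\top/\Delta)$ and $\hat W^\dagger$ its pseudo-inverse. **Algorithm (DFO-LS with criticality phase).** Parameters: $0<\Delta_0\le\Delta_{max}$, $0<\gamma_{dec}<1<\gamma_{inc}\le\overline\gamma_{inc}$, $0<\alpha_1<\alpha_2<1$,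 $0<\eta_1\le\eta_2<1$, $\omega_S,\omega_C\in(0,1)$, $\mu,\epsilon_C>0$, $\Lambda\ge1$, $c_1\in[\frac12,1]$, $0<\gamma_S<\min\{1,2c_1/(1+\sqrt{1+2c_1})\}$. Start from $x_0$, $Y_0\subset B(x_0,\Delta_0)$ with $p+1$ points including $x_0$, and $\Delta_0^{init}=\rho_0^{init}=\Delta_0$. For $k=0,1,2,\dots$ (without termination test): 1. Build a regression model from $Y_k$ at $x_k$. If its gradient satisfies $\|g\|>\epsilon_C$, accept it as $m_k$, with $\Delta_k=\Delta_k^{init}$, $\rho_k=\rho_k^{init}$. Otherwise (criticality phase), for $i=0,1,\dots$: replace $Y_k$ by a $\Lambda$-poised set in $B(x_k,\omega_C^i\Delta_k^{init})$ containing $x_k$ and build its model, until $\omega_C^i\Delta_k^{init}\le\mu\|g\|$; accept this model, with $\Delta_k=\omega_C^i\Delta_k^{init}$ and $\rho_k=\min(\rho_k^{init},\Delta_k)$. 2. Compute a step $s_k$, $\|s_k\|\le\Delta_k$. If $\|s_k\|<\gamma_S\rho_k$ (safety): put $x_{k+1}=x_k$, $\Delta^+=\max(\rho_k,\omega_S\Delta_k)$,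 and choose $Y_{k+1}\ni x_{k+1}$ $\Lambda$-poised in $B(x_{k+1},\Delta^+)$; go to 4. 3. Otherwise evaluate $r(x_k+s_k)$, let $q_k=\frac{f(x_k)-f(x_k+s_k)}{m_k(0)-m_k(s_k)}$ and $$\Delta^+=\begin{cases}\min(\max(\gamma_{inc}\Delta_k,\overline\gamma_{inc}\|s_k\|),\Delta_{max}),&q_k\ge\eta_2,\\ \max(\gamma_{dec}\Delta_k,\|s_k\|,\rho_k),&\eta_1\le q_k<\eta_2,\\ \max(\min(\gamma_{dec}\Delta_k,\|s_k\|),\rho_k),&q_k<\eta_1.\end{cases}$$ If $q_k\ge\eta_1$: $x_{k+1}=x_k+s_k$, which replaces some point of $Y_k$, and $(\rho_{k+1}^{init},\Delta_{k+1}^{init})=(\rho_k,\Delta^+)$. If $q_k<\eta_1$ and $Y_k$ is not $\Lambda$-poised in $B(x_k,\Delta_k)$: $x_{k+1}=x_k$, $Y_{k+1}\ni x_{k+1}$ is made $\Lambda$-poised in $B(x_{k+1},\Delta^+)$, and $(\rho_{k+1}^{init},\Delta_{k+1}^{init})=(\rho_k,\Delta^+)$. Otherwise $x_{k+1}=x_k$,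 $Y_{k+1}=Y_k$, and go to 4. 4. $(\rho_{k+1}^{init},\Delta_{k+1}^{init})=(\alpha_1\rho_k,\alpha_2\rho_k)$ if $\Delta^+=\rho_k$, and $(\rho_k,\Delta^+)$ otherwise. **Assumptions.** (i) $r$ is $C^1$ and on the convex hull of $\bigcup_kB(x_k,\Delta_{max})$ its Jacobian $J$ is $L_J$-Lipschitz, $\|r\|\le r_{max}$, $\|J\|\le J_{max}$. (ii) $m_k(0)-m_k(s_k)\ge c_1\|g_k\|\min(\Delta_k,\|g_k\|/\max(\|H_k\|,1))$ for all $k$. (iii) $\|H_k\|\le\kappa_H$ for all $k$, where $\kappa_H\ge1$. (iv) $\epsilon_C\ge c_3\epsilon$, where $c_3>0$. (v) $C\ge0$ satisfies $\|\hat W^\dagger\|\le C$ for every set from which the execution builds a model and which is $\Lambda$-poised in the current ball. **Constants.** $\kappa^r_{eg}=\frac12L_J(\sqrt p\,C+2)$, $L_{\nabla f}=r_{max}L_J+J_{max}^2$, $\kappa_{eg}=L_{\nabla f}+2J_{max}\kappa^r_{eg}\Delta_{max}+2\kappa^r_{eg}r_{max}+2(\kappa^r_{eg}\Delta_{max}+J_{max})^2$,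 $\kappa_{ef}=\kappa_{eg}+\frac12L_{\nabla f}+(2r_{max}+\kappa^r_{eg}\Delta_{max})\kappa^r_{eg}+(\kappa^r_{eg}\Delta_{max}+J_{max})^2$, and $\kappa_d=\max(\kappa_{ef},\kappa_{eg})$. **Corollary.** (a) Let $\epsilon\in(0,1]$. Count every construction of a model (also within the criticality phase) as an iteration. Then every execution of the algorithm satisfying (i)–(v) reaches an iterate with $\|\nabla f\|<\epsilon$ after at most $K\kappa_H\kappa_d^2\epsilon^{-2}$ iterations and at most $K\kappa_H\kappa_d^2\,p\,\epsilon^{-2}$ objective evaluations. Here $K$ depends only on $\Delta_0,\gamma_{dec},\overline\gamma_{inc},\alpha_1,\alpha_2,\eta_1,\eta_2,\omega_S,\omega_C,\mu,c_1,c_3$, on an upper bound for $f(x_0)$ and on a positive lower bound for $\kappa_d$. (b) $C=\sqrt{p+1}\,\Lambda$ is always admissible in (v): if $Y$ is $\Lambda$-poised in $B(x,\Delta)$, then $\|\hat W^\dagger\|\le\sqrt{p+1}\,\Lambda$. (c) If $C=O(\Lambda)$, then $\kappa_d=O(pL_J^2)$: given $\Lambda,C_0,r_{max},J_{max},\Delta_{max}$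 and $L_0>0$, there is $K'$ such that $\kappa_d\le K'pL_J^2$ for all $p\ge1$, $L_J\ge L_0$ and $0\le C\le C_0\Lambda$. -/

import Mathlib

noncomputable section

namespace DFOLS

open scoped InnerProductSpace

/-- `ℝⁿ` with the Euclidean norm. -/
abbrev Vec (n : ℕ) : Type := EuclideanSpace ℝ (Fin n)

/-- An interpolation set of `p + 1` points of `ℝⁿ`, listed as a family. -/
abbrev InterpSet (n p : ℕ) : Type := Fin (p + 1) → Vec n

/-- The least-squares objective `f(x) = ‖r(x)‖²`. -/
def objective {n m : ℕ} (r : Vec n → Vec m) (x : Vec n) : ℝ := ‖r x‖ ^ 2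

/-! ### Regression models -/

/-- A linear model `s ↦ rk + Jk s` of `r` around the current iterate. -/
structure Model (n m : ℕ) where
  rk : Vec m
  Jk : Vec n →L[ℝ] Vec m

namespace Model

variable {n m : ℕ}

/-- The vector model `s ↦ rk + Jk s`. -/
def vec (M : Model n m) (s : Vec n) : Vec m := M.rk + M.Jk s

/-- The scalar (Gauss-Newton) model `m_k(s) = ‖rk + Jk s‖²`. -/
def val (M : Model n m) (s : Vec n) : ℝ := ‖M.vec s‖ ^ 2

/-- `g_k = 2 Jkᵀ rk`. -/
def grad (M : Model n m) : Vec n := (2 : ℝ) • ContinuousLinearMap.adjoint M.Jk M.rk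

/-- `H_k = 2 Jkᵀ Jk`. -/
def hess (M : Model n m) : Vec n →L[ℝ] Vec n :=
  (2 : ℝ) • (ContinuousLinearMap.adjoint M.Jk).comp M.Jk

end Model

/-- The sum of squared interpolation errors of a model centred at `x`. -/
def regressionError {n m p : ℕ} (r : Vec n → Vec m) (Y : InterpSet n p) (x : Vec n)
    (M : Model n m) : ℝ :=
  ∑ t, ‖M.vec (Y t - x) - r (Y t)‖ ^ 2

/-- `M` solves the linear regression problem for `r` on `Y`, centred at `x`. -/
def IsRegressionModel {n m p : ℕ} (r : Vec n → Vec m) (Y : InterpSet n p) (x : Vec n)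
    (M : Model n m) : Prop :=
  ∀ M' : Model n m, regressionError r Y x M ≤ regressionError r Y x M'

/-! ### Geometry of interpolation sets -/

/-- The least-squares residual of `y ↦ c + gᵀ(y - x)` as a candidate for the `t`-th regression
Lagrange polynomial of `Y`. -/
def lagrangeError {n p : ℕ} (Y : InterpSet n p) (x : Vec n) (t : Fin (p + 1))
    (c : ℝ) (g : Vec n) : ℝ :=
  ∑ s, (c + ⟪g, Y s - x⟫_ℝ - if s = t then 1 else 0) ^ 2

/-- `y ↦ c + gᵀ(y - x)` is the `t`-th regression Lagrange polynomial of `Y`. -/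
def IsLagrange {n p : ℕ} (Y : InterpSet n p) (x : Vec n) (t : Fin (p + 1))
    (c : ℝ) (g : Vec n) : Prop :=
  ∀ (c' : ℝ) (g' : Vec n), lagrangeError Y x t c g ≤ lagrangeError Y x t c' g'

/-- The matrix with rows `(1, (y_t - x)ᵀ)` has full column rank. -/
def FullRank {n p : ℕ} (Y : InterpSet n p) (x : Vec n) : Prop :=
  ∀ (c : ℝ) (g : Vec n), (∀ t, c + ⟪g, Y t - x⟫_ℝ = 0) → c = 0 ∧ g = 0

/-- `Y` is `Λ`-poised in the ball `B(x, Δ)` in the regression sense: `p ≥ n`, the points lie in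
`B(x, Δ)`, the regression Lagrange polynomials exist uniquely (full column rank), and they are
bounded by `Λ` in absolute value on `B(x, Δ)`. -/
def IsPoised {n p : ℕ} (Λ : ℝ) (x : Vec n) (Δ : ℝ) (Y : InterpSet n p) : Prop :=
  n ≤ p ∧ (∀ t, Y t ∈ Metric.closedBall x Δ) ∧ FullRank Y x ∧
    ∀ (t : Fin (p + 1)) (c : ℝ) (g : Vec n), IsLagrange Y x t c g →
      ∀ y ∈ Metric.closedBall x Δ, |c + ⟪g, y - x⟫_ℝ| ≤ Λ

/-- The scaled interpolation matrix, with rows `(1, (y_t - x)ᵀ / Δ)`. -/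
def scaledMatrix {n p : ℕ} (Y : InterpSet n p) (x : Vec n) (Δ : ℝ) :
    Matrix (Fin (p + 1)) (Unit ⊕ Fin n) ℝ :=
  Matrix.of fun t => Sum.elim (fun _ => 1) (fun i => (Y t i - x i) / Δ)

section
open scoped Matrix.Norms.L2Operator Matrix

/-- The spectral norm `‖Ŵ†‖` of the pseudo-inverse `Ŵ† = (Ŵᵀ Ŵ)⁻¹ Ŵᵀ` of the scaled interpolation
matrix; it is only used when `Ŵ` has full column rank. -/
def pinvNorm {n p : ℕ} (Y : InterpSet n p) (x : Vec n) (Δ : ℝ) : ℝ :=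
  ‖((scaledMatrix Y x Δ)ᵀ * scaledMatrix Y x Δ)⁻¹ * (scaledMatrix Y x Δ)ᵀ‖

end

/-! ### Model accuracy constants -/

/-- `κ_eg^r = L_J (√p C + 2) / 2`. -/
def kappaEGr (p : ℕ) (C LJ : ℝ) : ℝ := 1 / 2 * LJ * (Real.sqrt p * C + 2)

/-- `L_{∇f} = r_max L_J + J_max²`. -/
def gradLip (LJ rmax Jmax : ℝ) : ℝ := rmax * LJ + Jmax ^ 2

/-- The constant `κ_eg`. -/
def kappaEG (p : ℕ) (C LJ rmax Jmax Δmax : ℝ) : ℝ :=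
  gradLip LJ rmax Jmax + 2 * Jmax * kappaEGr p C LJ * Δmax + 2 * kappaEGr p C LJ * rmax
    + 2 * (kappaEGr p C LJ * Δmax + Jmax) ^ 2

/-- The constant `κ_ef`. -/
def kappaEF (p : ℕ) (C LJ rmax Jmax Δmax : ℝ) : ℝ :=
  kappaEG p C LJ rmax Jmax Δmax + gradLip LJ rmax Jmax / 2
    + (2 * rmax + kappaEGr p C LJ * Δmax) * kappaEGr p C LJ
    + (kappaEGr p C LJ * Δmax + Jmax) ^ 2

/-- `κ_d = max(κ_ef, κ_eg)`. -/
def kappaD (p : ℕ) (C LJ rmax Jmax Δmax : ℝ) : ℝ :=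
  max (kappaEF p C LJ rmax Jmax Δmax) (kappaEG p C LJ rmax Jmax Δmax)

/-! ### The algorithm -/

/-- The algorithm parameters on which the constants of the complexity bound depend
(`c1` is the constant of the Cauchy decrease condition). -/
structure Params where
  Δ0 : ℝ
  γdec : ℝ
  γincBar : ℝ
  α1 : ℝ
  α2 : ℝ
  η1 : ℝ
  η2 : ℝ
  ωS : ℝ
  ωC : ℝ
  μ : ℝ
  c1 : ℝ
  Δ0_pos : 0 < Δ0
  γdec_pos : 0 < γdec
  γdec_lt : γdec < 1
  γincBar_gt : 1 < γincBar
  α1_pos : 0 < α1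
  α1_lt : α1 < α2
  α2_lt : α2 < 1
  η1_pos : 0 < η1
  η1_le : η1 ≤ η2
  η2_lt : η2 < 1
  ωS_pos : 0 < ωS
  ωS_lt : ωS < 1
  ωC_pos : 0 < ωC
  ωC_lt : ωC < 1
  μ_pos : 0 < μ
  c1_ge : 1 / 2 ≤ c1
  c1_le : c1 ≤ 1

/-- The remaining algorithm parameters. -/
structure MoreParams (P : Params) where
  Δmax : ℝ
  γinc : ℝ
  γS : ℝ
  εC : ℝ
  Λ : ℝ
  Δmax_ge : P.Δ0 ≤ Δmax
  γinc_gt : 1 < γinc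
  γinc_le : γinc ≤ P.γincBar
  γS_pos : 0 < γS
  γS_lt_one : γS < 1
  γS_lt : γS < 2 * P.c1 / (1 + Real.sqrt (1 + 2 * P.c1))
  εC_pos : 0 < εC
  Λ_ge : 1 ≤ Λ

/-- The state of the algorithm immediately before a model is built. If `inCrit = false`, this is the
start of a main iteration with data `x_k, Y_k, Δ_k^init, ρ_k^init`. If `inCrit = true`, the
criticality phase is running: `Y` is its current set, `Δ = ω_C^i Δ_k^init` its current radius, and
`ρ` is still `ρ_k^init`. -/
structure State (n p : ℕ) where
  x : Vec n
  Y : InterpSet n p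
  Δ : ℝ
  ρ : ℝ
  inCrit : Bool

/-- What the algorithm computes in one model-building iteration: the interpolation set from which
the model is built, the model, and the trust region step (irrelevant if no step is computed). -/
structure Record (n m p : ℕ) where
  Y : InterpSet n p
  model : Model n m
  s : Vec n

section Algorithm

variable {n m p : ℕ} {P : Params}

/-- The model just built is accepted as `m_k`: outside the criticality phase, because its gradient
exceeds the criticality threshold; inside, because the current radius is at most `μ ‖g_k‖`. -/
def Accepted (Q : MoreParams P) (S : State n p) (R : Record n m p) : Prop :=
  if S.inCrit = true then S.Δ ≤ P.μ * ‖R.model.grad‖ else Q.εC < ‖R.model.grad‖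

/-- The value `ρ_k` used with an accepted model. -/
def lowerRadius (S : State n p) : ℝ := if S.inCrit = true then min S.ρ S.Δ else S.ρ

/-- The ratio of actual to predicted decrease. -/
def ratio (r : Vec n → Vec m) (x : Vec n) (M : Model n m) (s : Vec n) : ℝ :=
  (objective r x - objective r (x + s)) / (M.val 0 - M.val s)

open Classical in
/-- The trust region radius update after a trial step with decrease ratio `q`. -/
def radiusUpdate (Q : MoreParams P) (Δ ρ σ q : ℝ) : ℝ :=
  if P.η2 ≤ q then min (max (Q.γinc * Δ) (P.γincBar * σ)) Q.Δmax
  else if P.η1 ≤ q then max (max (P.γdec * Δ) σ) ρ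
  else max (min (P.γdec * Δ) σ) ρ

/-- The new pair `(ρ, Δ)` after a tentative radius `Δ'`: if `Δ' = ρ` then both are reduced. -/
def ReduceIfEqual (P : Params) (ρ Δ' : ℝ) (S' : State n p) : Prop :=
  (Δ' = ρ → S'.ρ = P.α1 * ρ ∧ S'.Δ = P.α2 * ρ) ∧ (Δ' ≠ ρ → S'.ρ = ρ ∧ S'.Δ = Δ')

/-- `Y` is a `Λ`-poised set in `B(x, Δ)` that contains `x`. -/
def IsGoodSet (Q : MoreParams P) (x : Vec n) (Δ : ℝ) (Y : InterpSet n p) : Prop :=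
  IsPoised Q.Λ x Δ Y ∧ x ∈ Set.range Y

/-- Safety phase. -/
def SafetyPhase (Q : MoreParams P) (x : Vec n) (Δ ρ : ℝ) (S' : State n p) : Prop :=
  S'.x = x ∧ IsGoodSet Q x (max ρ (P.ωS * Δ)) S'.Y ∧
    ReduceIfEqual P ρ (max ρ (P.ωS * Δ)) S'

/-- Successful phase. -/
def SuccessfulPhase (x : Vec n) (Y : InterpSet n p) (s : Vec n) (ρ Δ' : ℝ)
    (S' : State n p) : Prop :=
  S'.x = x + s ∧ (∃ t, S'.Y = Function.update Y t (x + s)) ∧ S'.ρ = ρ ∧ S'.Δ = Δ'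

/-- Model improvement phase. -/
def ModelImprovementPhase (Q : MoreParams P) (x : Vec n) (ρ Δ' : ℝ) (S' : State n p) : Prop :=
  S'.x = x ∧ IsGoodSet Q x Δ' S'.Y ∧ S'.ρ = ρ ∧ S'.Δ = Δ'

/-- Unsuccessful phase. -/
def UnsuccessfulPhase (P : Params) (x : Vec n) (Y : InterpSet n p) (ρ Δ' : ℝ)
    (S' : State n p) : Prop :=
  S'.x = x ∧ S'.Y = Y ∧ ReduceIfEqual P ρ Δ' S'

/-- The part of an iteration that follows the choice of `m_k`, `Δ_k`, `ρ_k`. -/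
def TrustRegionStep (Q : MoreParams P) (r : Vec n → Vec m) (x : Vec n) (R : Record n m p)
    (Δ ρ : ℝ) (S' : State n p) : Prop :=
  ‖R.s‖ ≤ Δ ∧ S'.inCrit = false ∧
  let q := ratio r x R.model R.s
  let Δ' := radiusUpdate Q Δ ρ ‖R.s‖ q
  (‖R.s‖ < Q.γS * ρ → SafetyPhase Q x Δ ρ S') ∧
  (Q.γS * ρ ≤ ‖R.s‖ → P.η1 ≤ q → SuccessfulPhase x R.Y R.s ρ Δ' S') ∧
  (Q.γS * ρ ≤ ‖R.s‖ → q < P.η1 → ¬ IsPoised Q.Λ x Δ R.Y →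
    ModelImprovementPhase Q x ρ Δ' S') ∧
  (Q.γS * ρ ≤ ‖R.s‖ → q < P.η1 → IsPoised Q.Λ x Δ R.Y →
    UnsuccessfulPhase P x R.Y ρ Δ' S')

/-- One model-building iteration from state `S` to state `S'`. Outside the criticality phase the
model is built from the current set; inside, the set is first made `Λ`-poised for the current
radius. If the model is not accepted, the criticality phase is entered (with radius `Δ_k^init`), or
continued with the radius multiplied by `ω_C`. -/
def Step (Q : MoreParams P) (r : Vec n → Vec m) (S : State n p) (R : Record n m p)
    (S' : State n p) : Prop :=
  (S.inCrit = false → R.Y = S.Y) ∧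
  (S.inCrit = true → IsGoodSet Q S.x S.Δ R.Y) ∧
  IsRegressionModel r R.Y S.x R.model ∧
  (Accepted Q S R → TrustRegionStep Q r S.x R S.Δ (lowerRadius S) S') ∧
  (¬ Accepted Q S R →
    S'.x = S.x ∧ S'.Y = R.Y ∧ S'.ρ = S.ρ ∧ S'.inCrit = true ∧
      S'.Δ = if S.inCrit = true then P.ωC * S.Δ else S.Δ)

/-- An execution of the algorithm from `x0`: `S j` is the state before the `j`-th model is built. -/
structure IsExecution (Q : MoreParams P) (r : Vec n → Vec m) (x0 : Vec n)
    (S : ℕ → State n p) (R : ℕ → Record n m p) : Prop where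
  x_zero : (S 0).x = x0
  Y_zero_mem : ∀ t, (S 0).Y t ∈ Metric.closedBall x0 P.Δ0
  x_mem_Y_zero : x0 ∈ Set.range (S 0).Y
  Δ_zero : (S 0).Δ = P.Δ0
  ρ_zero : (S 0).ρ = P.Δ0
  inCrit_zero : (S 0).inCrit = false
  step : ∀ j, Step Q r (S j) (R j) (S (j + 1))

open Classical in
/-- The points at which the objective is evaluated in an iteration: those brought into the
interpolation set before the model is built, the trial point `x_k + s_k` (if it is reached), and
those brought into the interpolation set afterwards. -/
def newPoints (Q : MoreParams P) (S : State n p) (R : Record n m p) (S' : State n p) :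
    Finset (Vec n) :=
  (Finset.univ.image R.Y \ Finset.univ.image S.Y)
    ∪ (if Accepted Q S R ∧ Q.γS * lowerRadius S ≤ ‖R.s‖ then {S.x + R.s} else ∅)
    ∪ (Finset.univ.image S'.Y \ Finset.univ.image R.Y)

/-- The number of objective evaluations used by the first `N` iterations, including those on the
initial interpolation set. -/
def evaluations (Q : MoreParams P) (S : ℕ → State n p) (R : ℕ → Record n m p) (N : ℕ) : ℕ :=
  (p + 1) + ∑ j ∈ Finset.range N, (newPoints Q (S j) (R j) (S (j + 1))).card

/-! ### Assumptions -/

/-- The convex hull of the balls `B(x_k, Δ_max)` around the iterates. -/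
def region (Q : MoreParams P) (S : ℕ → State n p) : Set (Vec n) :=
  convexHull ℝ (⋃ j, Metric.closedBall (S j).x Q.Δmax)

/-- `r` is `C¹`, and on the region its Jacobian is `LJ`-Lipschitz, `‖r‖ ≤ rmax`, `‖J‖ ≤ Jmax`. -/
structure SmoothnessAssumption (Q : MoreParams P) (r : Vec n → Vec m) (S : ℕ → State n p)
    (LJ rmax Jmax : ℝ) : Prop where
  contDiff : ContDiff ℝ 1 r
  lipschitz : ∀ x ∈ region Q S, ∀ y ∈ region Q S,
    ‖fderiv ℝ r x - fderiv ℝ r y‖ ≤ LJ * ‖x - y‖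
  bound_r : ∀ x ∈ region Q S, ‖r x‖ ≤ rmax
  bound_J : ∀ x ∈ region Q S, ‖fderiv ℝ r x‖ ≤ Jmax

/-- Every computed step satisfies the Cauchy decrease condition with constant `c1`. -/
def CauchyDecrease (Q : MoreParams P) (S : ℕ → State n p) (R : ℕ → Record n m p) : Prop :=
  ∀ j, Accepted Q (S j) (R j) →
    P.c1 * ‖(R j).model.grad‖ *
        min (S j).Δ (‖(R j).model.grad‖ / max ‖(R j).model.hess‖ 1)
      ≤ (R j).model.val 0 - (R j).model.val (R j).s

/-- `‖H_k‖ ≤ κH` for all the models `m_k`. -/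
def BoundedHessian (Q : MoreParams P) (S : ℕ → State n p) (R : ℕ → Record n m p)
    (κH : ℝ) : Prop :=
  ∀ j, Accepted Q (S j) (R j) → ‖(R j).model.hess‖ ≤ κH

/-- `C` bounds the pseudo-inverses of the scaled interpolation matrices of all the `Λ`-poised sets
from which a model is built in the execution. -/
def BoundsPinv (Q : MoreParams P) (S : ℕ → State n p) (R : ℕ → Record n m p) (C : ℝ) : Prop :=
  ∀ j, IsPoised Q.Λ (S j).x (S j).Δ (R j).Y → pinvNorm (R j).Y (S j).x (S j).Δ ≤ C

end Algorithm

end DFOLS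

end

/-! Parts (b) and (c) are direct. The columns of the pseudo-inverse are the scaled coefficients of
the regression Lagrange polynomials. An affine function bounded by `Λ` on the ball has a scaled
coefficient vector of norm at most `Λ`, and Cauchy–Schwarz over the `p + 1` columns gives (b)
(`pinvNorm_le`). For (c), `κ_d` is bounded by a quadratic in `√p L_J` (`kappaD_le`).

Part (a) rests on three facts. First, a model built from a poised set is fully linear with constant
`κ = 26 κ_d` (`model_accuracy`): regression applied to the Taylor residuals of `r` amplifies them by
at most `C √(p+1)`.

Second, while `‖∇f‖ ≥ ε`, accepted model gradients are at least `e`, of order `ε/κ`, and all radii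
at least `δ`, of order `ε/(κ κ_H)`. The reason is that a poised set with a small radius yields a
successful step, and that `ρ` is reduced only after a safety step or a failure on a poised set.

Third, every iteration has one of three outcomes (`step_progress`). The objective drops by `d = η₁
c₁ e δ` while the radius grows by a bounded factor; or the radius contracts by a fixed factor; or
the radius does not grow and the stage rises in the order unpoised, poised, critical. A weighted sum
of `log Δ`, minus the stage, and `f` therefore falls by at least `1` per iteration
(`MakesProgress.potential_le`). It is bounded below because `Δ ≥ δ` and `f ≥ 0`, so the number of
iterations is of order `1/δ + f(x₀)/d`, and `1/d` is of order `κ_H κ² ε⁻²`. -/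

noncomputable section

namespace DFOLS

open scoped InnerProductSpace

/-! ### Pseudo-inverses and regression Lagrange polynomials -/

section PseudoInverse

open scoped Matrix.Norms.L2Operator Matrix

variable {n p : ℕ}

/-- The pseudo-inverse `(Ŵᵀ Ŵ)⁻¹ Ŵᵀ` of the scaled interpolation matrix. -/
def pinv (Y : InterpSet n p) (x : Vec n) (Δ : ℝ) : Matrix (Unit ⊕ Fin n) (Fin (p + 1)) ℝ :=
  ((scaledMatrix Y x Δ)ᵀ * scaledMatrix Y x Δ)⁻¹ * (scaledMatrix Y x Δ)ᵀ

/-- The coefficients of `y ↦ c + gᵀ(y - x)` in the scaled basis `1, (y - x) / Δ`. -/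
def scaledCoeff (Δ c : ℝ) (g : Vec n) : Unit ⊕ Fin n → ℝ :=
  Sum.elim (fun _ => c) fun i => Δ * g i

lemma exists_scaledCoeff_eq {Δ : ℝ} (hΔ : 0 < Δ) (w : Unit ⊕ Fin n → ℝ) :
    ∃ (c : ℝ) (g : Vec n), scaledCoeff Δ c g = w := by
  refine ⟨w (Sum.inl ()), WithLp.toLp 2 fun i => w (Sum.inr i) / Δ, ?_⟩
  funext i
  rcases i with _ | i
  · rfl
  · simp [scaledCoeff, mul_div_cancel₀ _ hΔ.ne']

lemma scaledMatrix_mulVec_scaledCoeff (Y : InterpSet n p) (x : Vec n) {Δ : ℝ} (hΔ : 0 < Δ)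
    (c : ℝ) (g : Vec n) :
    scaledMatrix Y x Δ *ᵥ scaledCoeff Δ c g = fun t => c + ⟪g, Y t - x⟫_ℝ := by
  funext t
  simp only [scaledMatrix, scaledCoeff, Matrix.mulVec, dotProduct, Matrix.of_apply,
    Fintype.sum_sum_type, Sum.elim_inl, Sum.elim_inr, PiLp.inner_apply, PiLp.sub_apply,
    Finset.univ_unique, Finset.sum_singleton, one_mul]
  congr 1
  refine Finset.sum_congr rfl fun i _ => ?_
  simp only [RCLike.inner_apply, conj_trivial]
  field_simp

lemma norm_scaledCoeff_sq (Δ c : ℝ) (g : Vec n) :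
    ‖WithLp.toLp 2 (scaledCoeff Δ c g)‖ ^ 2 = c ^ 2 + Δ ^ 2 * ‖g‖ ^ 2 := by
  rw [EuclideanSpace.real_norm_sq_eq, EuclideanSpace.real_norm_sq_eq, Fintype.sum_sum_type,
    Finset.mul_sum]
  simp [scaledCoeff, mul_pow]

/-- The Gram matrix has the same kernel as `Ŵ`, and scaling the columns by `1/Δ` does not affect
full rank. -/
lemma isUnit_gram {Y : InterpSet n p} {x : Vec n} {Δ : ℝ} (hΔ : 0 < Δ) (hY : FullRank Y x) :
    IsUnit ((scaledMatrix Y x Δ)ᵀ * scaledMatrix Y x Δ) := by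
  rw [← Matrix.mulVec_injective_iff_isUnit]
  refine (injective_iff_map_eq_zero
    ((scaledMatrix Y x Δ)ᵀ * scaledMatrix Y x Δ).mulVecLin).2 fun w hw => ?_
  rw [Matrix.mulVecLin_apply, ← Matrix.conjTranspose_eq_transpose_of_trivial,
    Matrix.conjTranspose_mul_self_mulVec_eq_zero] at hw
  obtain ⟨c, g, rfl⟩ := exists_scaledCoeff_eq hΔ w
  rw [scaledMatrix_mulVec_scaledCoeff Y x hΔ] at hw
  obtain ⟨rfl, rfl⟩ := hY c g fun t => congrFun hw t
  funext i
  rcases i with _ | i <;> simp [scaledCoeff]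

/-- The normal equations characterize the regression polynomial. -/
lemma scaledCoeff_eq_pinv_mulVec {Y : InterpSet n p} {x : Vec n} {Δ : ℝ} (hΔ : 0 < Δ)
    (hY : FullRank Y x) {v : Fin (p + 1) → ℝ} {c : ℝ} {g : Vec n} :
    scaledCoeff Δ c g = pinv Y x Δ *ᵥ v ↔
      ∀ (c' : ℝ) (g' : Vec n),
        ∑ t, (c + ⟪g, Y t - x⟫_ℝ - v t) * (c' + ⟪g', Y t - x⟫_ℝ) = 0 := by
  set W := scaledMatrix Y x Δ with hW
  have hU := (Matrix.isUnit_iff_isUnit_det _).1 (isUnit_gram hΔ hY)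
  have h1 : scaledCoeff Δ c g = pinv Y x Δ *ᵥ v ↔
      Wᵀ *ᵥ (W *ᵥ scaledCoeff Δ c g - v) = 0 := by
    rw [Matrix.mulVec_sub, sub_eq_zero, Matrix.mulVec_mulVec]
    constructor
    · intro h
      rw [h, pinv, Matrix.mulVec_mulVec, ← Matrix.mul_assoc, Matrix.mul_nonsing_inv _ hU,
        Matrix.one_mul]
    · intro h
      rw [pinv, ← Matrix.mulVec_mulVec, ← h, Matrix.mulVec_mulVec, Matrix.nonsing_inv_mul _ hU,
        Matrix.one_mulVec]
  have h2 : ∀ c' g', ∑ t, (c + ⟪g, Y t - x⟫_ℝ - v t) * (c' + ⟪g', Y t - x⟫_ℝ) =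
      (Wᵀ *ᵥ (W *ᵥ scaledCoeff Δ c g - v)) ⬝ᵥ scaledCoeff Δ c' g' := by
    intro c' g'
    rw [Matrix.mulVec_transpose, ← Matrix.dotProduct_mulVec, hW,
      scaledMatrix_mulVec_scaledCoeff Y x hΔ, scaledMatrix_mulVec_scaledCoeff Y x hΔ]
    rfl
  rw [h1]
  simp only [h2]
  constructor
  · intro h c' g'
    rw [h, zero_dotProduct]
  · intro h
    obtain ⟨c', g', h'⟩ := exists_scaledCoeff_eq hΔ (Wᵀ *ᵥ (W *ᵥ scaledCoeff Δ c g - v))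
    have := h c' g'
    rwa [h', dotProduct_self_eq_zero] at this

lemma pinvNorm_nonneg (Y : InterpSet n p) (x : Vec n) (Δ : ℝ) : 0 ≤ pinvNorm Y x Δ :=
  norm_nonneg _

lemma norm_pinv_mulVec_le (Y : InterpSet n p) (x : Vec n) (Δ : ℝ) (v : Fin (p + 1) → ℝ) :
    ‖WithLp.toLp 2 (pinv Y x Δ *ᵥ v)‖ ≤ pinvNorm Y x Δ * ‖WithLp.toLp 2 v‖ :=
  Matrix.l2_opNorm_mulVec (pinv Y x Δ) (WithLp.toLp 2 v)

/-- Pythagoras: the residual is orthogonal to every affine function on `Y`, so the cross term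
vanishes and any other candidate adds a sum of squares. -/
lemma isLagrange_of_normal_eq {Y : InterpSet n p} {x : Vec n} {t : Fin (p + 1)} {c : ℝ}
    {g : Vec n}
    (h : ∀ (c' : ℝ) (g' : Vec n), ∑ s, (c + ⟪g, Y s - x⟫_ℝ - (Pi.single t 1 : _ → ℝ) s) *
      (c' + ⟪g', Y s - x⟫_ℝ) = 0) :
    IsLagrange Y x t c g := by
  intro c' g'
  have h0 := h (c' - c) (g' - g)
  have hle : 0 ≤ ∑ s, (c' - c + ⟪g' - g, Y s - x⟫_ℝ) ^ 2 :=
    Finset.sum_nonneg fun _ _ => sq_nonneg _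
  have key : lagrangeError Y x t c' g' = lagrangeError Y x t c g
      + 2 * ∑ s, (c + ⟪g, Y s - x⟫_ℝ - (Pi.single t 1 : _ → ℝ) s) *
        (c' - c + ⟪g' - g, Y s - x⟫_ℝ)
      + ∑ s, (c' - c + ⟪g' - g, Y s - x⟫_ℝ) ^ 2 := by
    unfold lagrangeError
    rw [Finset.mul_sum, ← Finset.sum_add_distrib, ← Finset.sum_add_distrib]
    refine Finset.sum_congr rfl fun s _ => ?_
    rw [inner_sub_left, Pi.single_apply]
    ring
  rw [key, h0]
  linarith

/-- An affine function bounded by `Λ` on `B(x, Δ)` has scaled coefficients of norm at most `Λ`. -/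
lemma norm_scaledCoeff_le {x : Vec n} {Δ Λ c : ℝ} {g : Vec n} (hΔ : 0 < Δ)
    (h : ∀ y ∈ Metric.closedBall x Δ, |c + ⟪g, y - x⟫_ℝ| ≤ Λ) :
    ‖WithLp.toLp 2 (scaledCoeff Δ c g)‖ ≤ Λ := by
  -- On the diameter parallel to `g` the affine function takes the values `c + τ‖g‖`. The two ends
  -- give `|c| + Δ‖g‖ ≤ Λ`, which dominates the Euclidean norm.
  have hdir : ∀ τ : ℝ, |τ| ≤ Δ → |c + τ * ‖g‖| ≤ Λ := by
    intro τ hτ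
    rcases eq_or_ne g 0 with rfl | hg
    · simpa using h x (Metric.mem_closedBall_self hΔ.le)
    have hg' : ‖g‖ ≠ 0 := norm_ne_zero_iff.2 hg
    have := h (x + (τ / ‖g‖) • g) (by
      rw [mem_closedBall_iff_norm, add_sub_cancel_left, norm_smul, norm_div, norm_norm,
        div_mul_cancel₀ _ hg', Real.norm_eq_abs]
      exact hτ)
    rw [add_sub_cancel_left, inner_smul_right, real_inner_self_eq_norm_sq] at this
    convert this using 3
    field_simp
  have h1 := abs_le.1 (hdir Δ (abs_of_pos hΔ).le)
  have h2 := abs_le.1 (hdir (-Δ) (by rw [abs_neg, abs_of_pos hΔ]))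
  have hΛ : 0 ≤ Λ := (abs_nonneg _).trans (hdir Δ (abs_of_pos hΔ).le)
  refine abs_le_of_sq_le_sq' ?_ hΛ |>.2
  rw [norm_scaledCoeff_sq]
  have hg : 0 ≤ Δ * ‖g‖ := by positivity
  rcases le_total 0 c with hc | hc
  · nlinarith [mul_nonneg hc hg]
  · nlinarith [mul_nonneg (neg_nonneg.2 hc) hg]

/-- Column `t` of the pseudo-inverse solves the regression problem with data `δ_{st}`, hence is a
Lagrange polynomial and has norm at most `Λ`. The factor `√(p+1)` compares the `ℓ¹` and `ℓ²` norms
of the argument. -/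
theorem pinvNorm_le {Λ Δ : ℝ} {x : Vec n} {Y : InterpSet n p} (hΔ : 0 < Δ)
    (hY : IsPoised Λ x Δ Y) : pinvNorm Y x Δ ≤ Real.sqrt (p + 1) * Λ := by
  obtain ⟨-, -, hrank, hbound⟩ := hY
  have hcol : ∀ t, ‖WithLp.toLp 2 (pinv Y x Δ *ᵥ Pi.single t 1)‖ ≤ Λ := by
    intro t
    obtain ⟨c, g, hcg⟩ := exists_scaledCoeff_eq hΔ (pinv Y x Δ *ᵥ Pi.single t 1)
    rw [← hcg]
    exact norm_scaledCoeff_le hΔ (hbound t c g (isLagrange_of_normal_eq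
      ((scaledCoeff_eq_pinv_mulVec hΔ hrank).1 hcg)))
  have hΛ : 0 ≤ Λ := (norm_nonneg _).trans (hcol 0)
  refine ContinuousLinearMap.opNorm_le_bound _ (by positivity) fun v => ?_
  change ‖WithLp.toLp 2 (pinv Y x Δ *ᵥ v.ofLp)‖ ≤ _
  have hv : WithLp.toLp 2 (pinv Y x Δ *ᵥ v.ofLp) =
      ∑ t, v t • WithLp.toLp 2 (pinv Y x Δ *ᵥ Pi.single t 1) := by
    ext i
    simp [Matrix.mulVec, dotProduct, mul_comm]
  rw [hv]
  calc ‖∑ t, v t • WithLp.toLp 2 (pinv Y x Δ *ᵥ Pi.single t 1)‖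
      ≤ ∑ t, |v t| * Λ := by
        refine norm_sum_le_of_le _ fun t _ => ?_
        rw [norm_smul, Real.norm_eq_abs]
        exact mul_le_mul_of_nonneg_left (hcol t) (abs_nonneg _)
    _ = (∑ t, |v t|) * Λ := by rw [Finset.sum_mul]
    _ ≤ (Real.sqrt (p + 1) * ‖v‖) * Λ := by
        refine mul_le_mul_of_nonneg_right ?_ hΛ
        refine abs_le_of_sq_le_sq' ?_ (by positivity) |>.2
        rw [mul_pow, Real.sq_sqrt (by positivity), EuclideanSpace.real_norm_sq_eq]
        have := sq_sum_le_card_mul_sum_sq (s := Finset.univ) (f := fun t => |v t|)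
        simpa using this
    _ = Real.sqrt (p + 1) * Λ * ‖v‖ := by ring

/-- Solutions of a linear regression problem are bounded by the data. -/
lemma coeff_le_of_normal_eq {Y : InterpSet n p} {x : Vec n} {Δ C : ℝ} (hΔ : 0 < Δ)
    (hY : FullRank Y x) (hC : pinvNorm Y x Δ ≤ C) {v : Fin (p + 1) → ℝ} {c b : ℝ} {g : Vec n}
    (hb : 0 ≤ b) (hv : ∀ t, |v t| ≤ b)
    (h : ∀ (c' : ℝ) (g' : Vec n),
        ∑ t, (c + ⟪g, Y t - x⟫_ℝ - v t) * (c' + ⟪g', Y t - x⟫_ℝ) = 0) :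
    |c| ≤ C * (Real.sqrt (p + 1) * b) ∧ Δ * ‖g‖ ≤ C * (Real.sqrt (p + 1) * b) := by
  have hC0 : 0 ≤ C := (pinvNorm_nonneg Y x Δ).trans hC
  have hvb : ‖WithLp.toLp 2 v‖ ≤ Real.sqrt (p + 1) * b := by
    refine abs_le_of_sq_le_sq' ?_ (by positivity) |>.2
    rw [mul_pow, Real.sq_sqrt (by positivity), EuclideanSpace.real_norm_sq_eq]
    calc ∑ t, v t ^ 2 ≤ ∑ _t : Fin (p + 1), b ^ 2 :=
          Finset.sum_le_sum fun t _ => sq_le_sq' (abs_le.1 (hv t)).1 (abs_le.1 (hv t)).2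
      _ = (p + 1) * b ^ 2 := by simp
  have hz : ‖WithLp.toLp 2 (scaledCoeff Δ c g)‖ ≤ C * (Real.sqrt (p + 1) * b) := by
    rw [(scaledCoeff_eq_pinv_mulVec hΔ hY).2 h]
    exact (norm_pinv_mulVec_le Y x Δ v).trans (mul_le_mul hC hvb (norm_nonneg _) hC0)
  have hsq := norm_scaledCoeff_sq Δ c g
  constructor
  · refine le_trans (abs_le_of_sq_le_sq ?_ (norm_nonneg _)) hz
    rw [hsq]
    nlinarith [mul_nonneg (sq_nonneg Δ) (sq_nonneg ‖g‖)]
  · refine le_trans (abs_le_of_sq_le_sq' ?_ (norm_nonneg _)).2 hz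
    rw [hsq]
    nlinarith [sq_nonneg c]

end PseudoInverse

/-! ### Growth of `κ_d` -/

/-- With `T = √p L_J`, the constant `κ_eg^r` is at most `A T`. The lower bound `T ≥ L0` turns each
remaining constant `a` into at most `(a / L0) T`, so every term of `κ_d` becomes a multiple of `T²`.
-/
theorem kappaD_le {Λ C0 rmax Jmax Δmax L0 : ℝ} (hΛ : 1 ≤ Λ) (hC0 : 0 < C0) (hr : 0 ≤ rmax)
    (hJ : 0 ≤ Jmax) (hΔ : 0 < Δmax) (hL0 : 0 < L0) :
    ∃ K : ℝ, 0 < K ∧ ∀ (p : ℕ) (C LJ : ℝ), 1 ≤ p → 0 ≤ C → C ≤ C0 * Λ → L0 ≤ LJ →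
      kappaD p C LJ rmax Jmax Δmax ≤ K * (p * LJ ^ 2) := by
  set A := C0 * Λ + 2 with hA
  set B := rmax / L0 + Jmax ^ 2 / L0 ^ 2 with hB
  set D := A * Δmax + Jmax / L0 with hD
  set K1 := B + 2 * (Jmax / L0) * A * Δmax + 2 * A * (rmax / L0) + 2 * D ^ 2 with hK1
  set K2 := K1 + B + (2 * (rmax / L0) + A * Δmax) * A + D ^ 2 with hK2
  have hA0 : 0 < A := by positivity
  have hB0 : 0 ≤ B := by positivity
  have hD0 : 0 < D := by positivity
  have hK10 : 0 < K1 := by positivity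
  have hK20 : 0 < K2 := by positivity
  refine ⟨K2, hK20, fun p C LJ hp hC hCle hL => ?_⟩
  have hLJ : 0 < LJ := hL0.trans_le hL
  have hp' : (1 : ℝ) ≤ Real.sqrt p := Real.one_le_sqrt.2 (by exact_mod_cast hp)
  obtain ⟨T, hT⟩ : ∃ T, T = Real.sqrt p * LJ := ⟨_, rfl⟩
  have hT0 : 0 < T := by rw [hT]; positivity
  have hTsq : T ^ 2 = p * LJ ^ 2 := by
    rw [hT, mul_pow, Real.sq_sqrt (Nat.cast_nonneg p)]
  have hLT : LJ ≤ T := by rw [hT]; nlinarith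
  have hL0T : L0 ≤ T := hL.trans hLT
  have hscale : ∀ a, 0 ≤ a → a ≤ a / L0 * T := fun a ha => by
    rw [div_mul_eq_mul_div, le_div_iff₀ hL0]
    exact mul_le_mul_of_nonneg_left hL0T ha
  have hr' := hscale rmax hr
  have hJ' := hscale Jmax hJ
  set k := kappaEGr p C LJ with hk
  have hk0 : 0 ≤ k := by rw [hk, kappaEGr]; positivity
  have hkT : k ≤ A * T := by
    have h1 : Real.sqrt p * C + 2 ≤ 2 * (A * Real.sqrt p) := by nlinarith
    calc k = 1 / 2 * LJ * (Real.sqrt p * C + 2) := rfl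
      _ ≤ 1 / 2 * LJ * (2 * (A * Real.sqrt p)) := by gcongr
      _ = A * T := by rw [hT]; ring
  have hgl0 : 0 ≤ gradLip LJ rmax Jmax := by rw [gradLip]; positivity
  have hgl : gradLip LJ rmax Jmax ≤ B * T ^ 2 := by
    calc rmax * LJ + Jmax ^ 2 ≤ (rmax / L0 * T) * T + (Jmax / L0 * T) ^ 2 := by gcongr
      _ = B * T ^ 2 := by rw [hB]; ring
  have hkd : k * Δmax + Jmax ≤ D * T := by
    calc k * Δmax + Jmax ≤ (A * T) * Δmax + Jmax / L0 * T := by gcongr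
      _ = D * T := by rw [hD]; ring
  have hkdsq : (k * Δmax + Jmax) ^ 2 ≤ D ^ 2 * T ^ 2 := by
    rw [← mul_pow]; gcongr
  have hEG : kappaEG p C LJ rmax Jmax Δmax ≤ K1 * T ^ 2 := by
    have e2 : 2 * Jmax * k * Δmax ≤ 2 * (Jmax / L0 * T) * (A * T) * Δmax := by gcongr
    have e3 : 2 * k * rmax ≤ 2 * (A * T) * (rmax / L0 * T) := by gcongr
    have : K1 * T ^ 2 = B * T ^ 2 + 2 * (Jmax / L0 * T) * (A * T) * Δmax
        + 2 * (A * T) * (rmax / L0 * T) + 2 * (D ^ 2 * T ^ 2) := by rw [hK1]; ring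
    rw [this, kappaEG, ← hk]
    linarith
  have hrest : 0 ≤ B + (2 * (rmax / L0) + A * Δmax) * A + D ^ 2 := by positivity
  rw [← hTsq, kappaD]
  refine max_le ?_ (hEG.trans ?_)
  · have e2 : (2 * rmax + k * Δmax) * k ≤
        (2 * (rmax / L0 * T) + (A * T) * Δmax) * (A * T) := by gcongr
    have : K2 * T ^ 2 = K1 * T ^ 2 + B * T ^ 2
        + (2 * (rmax / L0 * T) + (A * T) * Δmax) * (A * T) + D ^ 2 * T ^ 2 := by
      rw [hK2]; ring
    rw [this, kappaEF, ← hk]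
    linarith
  · exact mul_le_mul_of_nonneg_right (by rw [hK2]; linarith) (sq_nonneg _)

/-! ### Accuracy of regression models -/

section Accuracy

variable {n m p : ℕ}

lemma eq_zero_of_forall_quadratic_nonneg {A B : ℝ} (hA : 0 ≤ A)
    (h : ∀ τ : ℝ, 0 ≤ 2 * τ * B + τ ^ 2 * A) : B = 0 := by
  -- The choice `1 + A` instead of `A` in the denominator also covers `A = 0`.
  have h1 := h (-B / (1 + A))
  have hpos : 0 < 1 + A := by linarith
  have h2 : 2 * (-B / (1 + A)) * B + (-B / (1 + A)) ^ 2 * A = -(B ^ 2 * (2 + A)) / (1 + A) ^ 2 := by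
    field_simp
    ring
  rw [h2, div_nonneg_iff] at h1
  have h3 : 0 < (1 + A) ^ 2 := by positivity
  rcases h1 with ⟨h1, -⟩ | ⟨-, h1⟩
  · have : B ^ 2 = 0 := by nlinarith [sq_nonneg B, mul_nonneg (sq_nonneg B) hA]
    exact pow_eq_zero_iff two_ne_zero |>.1 this
  · linarith

/-- Perturbing the model by `τ` times an affine function in direction `u` makes the error a
quadratic in `τ` with minimum at `0`, so its linear coefficient vanishes. -/
lemma regression_normal_eq {r : Vec n → Vec m} {Y : InterpSet n p} {x : Vec n} {M : Model n m}
    (hM : IsRegressionModel r Y x M) (u : Vec m) (c : ℝ) (g : Vec n) :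
    ∑ t, ⟪u, M.vec (Y t - x) - r (Y t)⟫_ℝ * (c + ⟪g, Y t - x⟫_ℝ) = 0 := by
  refine eq_zero_of_forall_quadratic_nonneg
    (A := ∑ t, (c + ⟪g, Y t - x⟫_ℝ) ^ 2 * ‖u‖ ^ 2)
    (Finset.sum_nonneg fun _ _ => by positivity) fun τ => ?_
  have h := hM ⟨M.rk + (τ * c) • u, M.Jk + τ • (innerSL ℝ g).smulRight u⟩
  have key : regressionError r Y x ⟨M.rk + (τ * c) • u, M.Jk + τ • (innerSL ℝ g).smulRight u⟩ =
      regressionError r Y x M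
        + 2 * τ * ∑ t, ⟪u, M.vec (Y t - x) - r (Y t)⟫_ℝ * (c + ⟪g, Y t - x⟫_ℝ)
        + τ ^ 2 * ∑ t, (c + ⟪g, Y t - x⟫_ℝ) ^ 2 * ‖u‖ ^ 2 := by
    unfold regressionError
    rw [Finset.mul_sum, Finset.mul_sum, ← Finset.sum_add_distrib, ← Finset.sum_add_distrib]
    refine Finset.sum_congr rfl fun t _ => ?_
    have : Model.vec ⟨M.rk + (τ * c) • u, M.Jk + τ • (innerSL ℝ g).smulRight u⟩ (Y t - x)
        - r (Y t) = (M.vec (Y t - x) - r (Y t)) + (τ * (c + ⟪g, Y t - x⟫_ℝ)) • u := by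
      simp only [Model.vec, add_apply, smul_apply,
        ContinuousLinearMap.smulRight_apply, innerSL_apply_apply]
      module
    rw [this, norm_add_sq_real, inner_smul_right, norm_smul,
      real_inner_comm u, mul_pow, Real.norm_eq_abs, sq_abs]
    ring
  rw [key] at h
  linarith

/-- A regression model is as close to an affine model as the residual values are on the
interpolation set. -/
lemma regression_error_le {r : Vec n → Vec m} {Y : InterpSet n p} {x : Vec n} {M : Model n m}
    {Δ C b : ℝ} (hΔ : 0 < Δ) (hY : FullRank Y x) (hC : pinvNorm Y x Δ ≤ C)
    (hM : IsRegressionModel r Y x M) {r0 : Vec m} {J0 : Vec n →L[ℝ] Vec m} (hb : 0 ≤ b)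
    (h : ∀ t, ‖r (Y t) - r0 - J0 (Y t - x)‖ ≤ b) :
    ‖M.rk - r0‖ ≤ C * (Real.sqrt (p + 1) * b) ∧
      Δ * ‖M.Jk - J0‖ ≤ C * (Real.sqrt (p + 1) * b) := by
  have hC0 : 0 ≤ C := (pinvNorm_nonneg _ _ _).trans hC
  -- Pairing with `u` reduces to scalar regression. Uniformity in `u` yields the vector and operator
  -- norms with no dependence on `m`.
  have main : ∀ u : Vec m, |⟪u, M.rk - r0⟫_ℝ| ≤ C * (Real.sqrt (p + 1) * (‖u‖ * b)) ∧
      Δ * ‖ContinuousLinearMap.adjoint (M.Jk - J0) u‖ ≤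
        C * (Real.sqrt (p + 1) * (‖u‖ * b)) := by
    intro u
    refine coeff_le_of_normal_eq hΔ hY hC
      (v := fun t => ⟪u, r (Y t) - r0 - J0 (Y t - x)⟫_ℝ) (by positivity) (fun t => ?_) ?_
    · exact (abs_real_inner_le_norm _ _).trans
        (mul_le_mul_of_nonneg_left (h t) (norm_nonneg _))
    · intro c' g'
      rw [← regression_normal_eq hM u c' g']
      refine Finset.sum_congr rfl fun t _ => ?_
      congr 1
      rw [ContinuousLinearMap.adjoint_inner_left, ← inner_add_right, ← inner_sub_right]
      congr 1
      simp only [Model.vec, sub_apply]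
      abel
  constructor
  · rcases eq_or_ne (M.rk - r0) 0 with h0 | h0
    · rw [h0, norm_zero]; positivity
    · have h1 := (main (M.rk - r0)).1
      rw [real_inner_self_eq_norm_sq, abs_of_nonneg (sq_nonneg _)] at h1
      have hpos : 0 < ‖M.rk - r0‖ := norm_pos_iff.2 h0
      nlinarith
  · rw [← ContinuousLinearMap.adjoint.norm_map (M.Jk - J0), mul_comm, ← le_div_iff₀ hΔ]
    refine ContinuousLinearMap.opNorm_le_bound _ (by positivity) fun u => ?_
    have := (main u).2
    rw [div_mul_eq_mul_div, le_div_iff₀ hΔ]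
    linarith

/-! ### Expansions of the objective and of the Gauss–Newton model -/

lemma hasGradientAt_objective {r : Vec n → Vec m} {x : Vec n} (hr : DifferentiableAt ℝ r x) :
    HasGradientAt (objective r) ((2 : ℝ) • ContinuousLinearMap.adjoint (fderiv ℝ r x) (r x)) x := by
  rw [hasGradientAt_iff_hasFDerivAt]
  refine hr.hasFDerivAt.norm_sq.congr_fderiv ?_
  ext v
  simp [ContinuousLinearMap.adjoint_inner_left]

lemma model_decrease_eq (M : Model n m) (s : Vec n) :
    M.val 0 - M.val s = -⟪M.grad, s⟫_ℝ - ‖M.Jk s‖ ^ 2 := by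
  simp only [Model.val, Model.vec, Model.grad, map_zero, add_zero, inner_smul_left,
    ContinuousLinearMap.adjoint_inner_left, norm_add_sq_real]
  simp
  ring

lemma model_decrease_le (M : Model n m) (s : Vec n) :
    M.val 0 - M.val s ≤ ‖M.grad‖ * ‖s‖ := by
  rw [model_decrease_eq]
  have := (abs_le.1 (abs_real_inner_le_norm M.grad s)).1
  nlinarith [sq_nonneg ‖M.Jk s‖]

variable {P : Params} {Q : MoreParams P} {r : Vec n → Vec m} {S : ℕ → State n p}
  {LJ rmax Jmax : ℝ}

lemma MoreParams.Δmax_pos (Q : MoreParams P) : 0 < Q.Δmax := P.Δ0_pos.trans_le Q.Δmax_ge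

lemma closedBall_subset_region (Q : MoreParams P) (S : ℕ → State n p) (j : ℕ) {Δ : ℝ}
    (hΔ : Δ ≤ Q.Δmax) : Metric.closedBall (S j).x Δ ⊆ region Q S :=
  (Metric.closedBall_subset_closedBall hΔ).trans
    ((Set.subset_iUnion (fun j => Metric.closedBall (S j).x Q.Δmax) j).trans
      (subset_convexHull ℝ _))

namespace SmoothnessAssumption

lemma iterate_mem (Q : MoreParams P) (S : ℕ → State n p) (j : ℕ) : (S j).x ∈ region Q S :=
  closedBall_subset_region Q S j le_rfl (Metric.mem_closedBall_self Q.Δmax_pos.le)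

lemma rmax_nonneg (h : SmoothnessAssumption Q r S LJ rmax Jmax) : 0 ≤ rmax :=
  (norm_nonneg _).trans (h.bound_r _ (iterate_mem Q S 0))

lemma Jmax_nonneg (h : SmoothnessAssumption Q r S LJ rmax Jmax) : 0 ≤ Jmax :=
  (norm_nonneg _).trans (h.bound_J _ (iterate_mem Q S 0))

/-- The Lipschitz bound forces a sign only if the region has two distinct points, hence `n ≥ 1`. -/
lemma LJ_nonneg (h : SmoothnessAssumption Q r S LJ rmax Jmax) (hn : 1 ≤ n) : 0 ≤ LJ := by
  have : Nonempty (Fin n) := ⟨⟨0, hn⟩⟩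
  obtain ⟨v, hv⟩ := exists_norm_eq (Vec n) Q.Δmax_pos.le
  have h1 := h.lipschitz ((S 0).x + v) (closedBall_subset_region Q S 0 le_rfl (by
    rw [mem_closedBall_iff_norm, add_sub_cancel_left, hv])) _ (iterate_mem Q S 0)
  rw [add_sub_cancel_left, hv] at h1
  exact nonneg_of_mul_nonneg_left ((norm_nonneg _).trans h1) Q.Δmax_pos

/-- The mean value inequality on the segment gives `LJ` rather than `LJ / 2`; the loss is absorbed
by the factor `26` in `model_accuracy`. -/
lemma linearization_error_le (h : SmoothnessAssumption Q r S LJ rmax Jmax) (hn : 1 ≤ n)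
    {x y : Vec n} (hx : x ∈ region Q S) (hy : y ∈ region Q S) :
    ‖r y - r x - fderiv ℝ r x (y - x)‖ ≤ LJ * ‖y - x‖ ^ 2 := by
  have hseg : segment ℝ x y ⊆ region Q S := (convex_convexHull ℝ _).segment_subset hx hy
  have := (convex_segment x y).norm_image_sub_le_of_norm_fderiv_le' (𝕜 := ℝ) (f := r)
    (φ := fderiv ℝ r x) (C := LJ * ‖y - x‖)
    (fun z _ => h.contDiff.differentiable one_ne_zero z) (fun z hz => ?_)
    (left_mem_segment ℝ x y) (right_mem_segment ℝ x y)
  · rwa [mul_assoc, ← sq] at this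
  · refine (h.lipschitz z (hseg hz) x hx).trans
      (mul_le_mul_of_nonneg_left ?_ (h.LJ_nonneg hn))
    obtain ⟨a, b, ha, hb, hab, rfl⟩ := hz
    have : a • x + b • y - x = b • (y - x) := by
      rw [← eq_sub_iff_add_eq] at hab
      rw [hab]
      module
    rw [this, norm_smul, Real.norm_eq_abs, abs_of_nonneg hb]
    exact mul_le_of_le_one_left (norm_nonneg _) (by linarith)

lemma norm_sub_le (h : SmoothnessAssumption Q r S LJ rmax Jmax)
    {x y : Vec n} (hx : x ∈ region Q S) (hy : y ∈ region Q S) :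
    ‖r y - r x‖ ≤ Jmax * ‖y - x‖ :=
  (convex_convexHull ℝ _).norm_image_sub_le_of_norm_fderiv_le (𝕜 := ℝ)
    (fun z _ => h.contDiff.differentiable one_ne_zero z) h.bound_J hx hy

lemma objective_taylor_le (h : SmoothnessAssumption Q r S LJ rmax Jmax) (hn : 1 ≤ n)
    {x y : Vec n} (hx : x ∈ region Q S) (hy : y ∈ region Q S) :
    |objective r y - objective r x - ⟪gradient (objective r) x, y - x⟫_ℝ| ≤
      2 * gradLip LJ rmax Jmax * ‖y - x‖ ^ 2 := by
  have e1 : objective r y - objective r x - ⟪gradient (objective r) x, y - x⟫_ℝ =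
      2 * ⟪r x, r y - r x - fderiv ℝ r x (y - x)⟫_ℝ + ‖r y - r x‖ ^ 2 := by
    rw [(hasGradientAt_objective (h.contDiff.differentiable one_ne_zero x)).gradient,
      inner_smul_left, ContinuousLinearMap.adjoint_inner_left, norm_sub_sq_real, inner_sub_right,
      inner_sub_right, real_inner_self_eq_norm_sq, real_inner_comm (r x) (r y)]
    simp only [objective, conj_trivial]
    ring
  have h1 : |⟪r x, r y - r x - fderiv ℝ r x (y - x)⟫_ℝ| ≤ rmax * (LJ * ‖y - x‖ ^ 2) :=
    (abs_real_inner_le_norm _ _).trans (mul_le_mul (h.bound_r x hx)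
      (h.linearization_error_le hn hx hy) (norm_nonneg _) h.rmax_nonneg)
  have h2 : ‖r y - r x‖ ^ 2 ≤ (Jmax * ‖y - x‖) ^ 2 :=
    pow_le_pow_left₀ (norm_nonneg _) (h.norm_sub_le hx hy) 2
  have h3 : 0 ≤ ‖r y - r x‖ ^ 2 := sq_nonneg _
  have h4 := mul_nonneg (sq_nonneg Jmax) (sq_nonneg ‖y - x‖)
  rw [e1, abs_le, gradLip]
  rw [abs_le] at h1
  constructor <;> nlinarith

end SmoothnessAssumption

/-- Models built from poised sets are fully linear: their gradients are first-order accurate and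
they predict the decrease of the objective to second order. -/
theorem model_accuracy (h : SmoothnessAssumption Q r S LJ rmax Jmax) (hn : 1 ≤ n) (hp : 1 ≤ p)
    {C Λ Δ : ℝ} {j : ℕ} {Y : InterpSet n p} {M : Model n m} (hΔ : 0 < Δ) (hΔmax : Δ ≤ Q.Δmax)
    (hY : IsPoised Λ (S j).x Δ Y) (hC : pinvNorm Y (S j).x Δ ≤ C)
    (hM : IsRegressionModel r Y (S j).x M) :
    ‖gradient (objective r) (S j).x - M.grad‖ ≤ 26 * kappaD p C LJ rmax Jmax Q.Δmax * Δ ∧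
    ∀ s, ‖s‖ ≤ Δ →
      |objective r (S j).x - objective r ((S j).x + s) - (M.val 0 - M.val s)| ≤
        26 * kappaD p C LJ rmax Jmax Q.Δmax * Δ ^ 2 := by
  set x := (S j).x with hx
  set κ := kappaEGr p C LJ with hκ
  set E := kappaEG p C LJ rmax Jmax Q.Δmax with hE
  set G := gradLip LJ rmax Jmax with hG
  have hC0 : 0 ≤ C := (pinvNorm_nonneg _ _ _).trans hC
  have hL0 := h.LJ_nonneg hn
  have hr0 := h.rmax_nonneg
  have hJ0 := h.Jmax_nonneg
  have hD0 := Q.Δmax_pos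
  have hκ0 : 0 ≤ κ := by rw [hκ, kappaEGr]; positivity
  have hG0 : 0 ≤ G := by rw [hG, gradLip]; positivity
  have hED : E ≤ kappaD p C LJ rmax Jmax Q.Δmax := le_max_right _ _
  have hEeq : E = G + 2 * Jmax * κ * Q.Δmax + 2 * κ * rmax + 2 * (κ * Q.Δmax + Jmax) ^ 2 := rfl
  have hxr : x ∈ region Q S := SmoothnessAssumption.iterate_mem Q S j
  have hball := closedBall_subset_region Q S j hΔmax
  obtain ⟨-, hYball, hrank, -⟩ := hY
  obtain ⟨hrk, hJk⟩ := regression_error_le hΔ hrank hC hM (r0 := r x) (J0 := fderiv ℝ r x)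
    (b := LJ * Δ ^ 2) (by positivity) fun t => by
      refine (h.linearization_error_le hn hxr (hball (hYball t))).trans ?_
      have := mem_closedBall_iff_norm.1 (hYball t)
      gcongr
  -- All `p + 1` residuals enter the regression bound, whereas `κ_eg^r` is stated with `√p`.
  have hsqrt : Real.sqrt (p + 1) ≤ 2 * Real.sqrt p := by
    rw [Real.sqrt_le_left (by positivity), mul_pow, Real.sq_sqrt (Nat.cast_nonneg p)]
    have : (1 : ℝ) ≤ p := by exact_mod_cast hp
    linarith
  have ha : C * (Real.sqrt (p + 1) * (LJ * Δ ^ 2)) ≤ 4 * κ * Δ ^ 2 := by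
    calc C * (Real.sqrt (p + 1) * (LJ * Δ ^ 2)) ≤ C * (2 * Real.sqrt p * (LJ * Δ ^ 2)) := by
          gcongr
      _ = 2 * LJ * (Real.sqrt p * C) * Δ ^ 2 := by ring
      _ ≤ 2 * LJ * (Real.sqrt p * C + 2) * Δ ^ 2 := by gcongr; linarith
      _ = 4 * κ * Δ ^ 2 := by rw [hκ, kappaEGr]; ring
  replace hrk := hrk.trans ha
  replace hJk : ‖M.Jk - fderiv ℝ r x‖ ≤ 4 * κ * Δ := by
    refine le_of_mul_le_mul_left ((hJk.trans ha).trans_eq ?_) hΔ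
    ring
  have hκΔ : κ * Δ ≤ κ * Q.Δmax := mul_le_mul_of_nonneg_left hΔmax hκ0
  have hJn : ‖M.Jk‖ ≤ 4 * (κ * Q.Δmax + Jmax) := by
    have h1 := norm_le_norm_add_norm_sub (fderiv ℝ r x) M.Jk
    rw [norm_sub_rev] at h1
    have h2 := h.bound_J x hxr
    linarith
  have hgrad : ‖gradient (objective r) x - M.grad‖ ≤ 16 * E * Δ := by
    have e1 : gradient (objective r) x - M.grad =
        (-2 : ℝ) • (ContinuousLinearMap.adjoint (M.Jk - fderiv ℝ r x) (r x)
          + ContinuousLinearMap.adjoint M.Jk (M.rk - r x)) := by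
      rw [(hasGradientAt_objective (h.contDiff.differentiable one_ne_zero x)).gradient,
        Model.grad, map_sub, map_sub, sub_apply]
      module
    have n1 : ‖ContinuousLinearMap.adjoint (M.Jk - fderiv ℝ r x) (r x)‖ ≤ 4 * κ * Δ * rmax := by
      refine (ContinuousLinearMap.le_opNorm _ _).trans ?_
      rw [ContinuousLinearMap.adjoint.norm_map]
      exact mul_le_mul hJk (h.bound_r x hxr) (norm_nonneg _) (by positivity)
    have n2 : ‖ContinuousLinearMap.adjoint M.Jk (M.rk - r x)‖ ≤
        4 * (κ * Q.Δmax + Jmax) * (4 * κ * Δ ^ 2) := by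
      refine (ContinuousLinearMap.le_opNorm _ _).trans ?_
      rw [ContinuousLinearMap.adjoint.norm_map]
      exact mul_le_mul hJn hrk (norm_nonneg _) (by positivity)
    have n3 : 4 * (κ * Q.Δmax + Jmax) * (4 * κ * Δ ^ 2) ≤
        16 * (κ * Q.Δmax + Jmax) * (κ * Q.Δmax) * Δ := by
      calc 4 * (κ * Q.Δmax + Jmax) * (4 * κ * Δ ^ 2)
          = 16 * (κ * Q.Δmax + Jmax) * (κ * Δ) * Δ := by ring
        _ ≤ _ := by gcongr
    have n4 : 2 * (4 * κ * rmax + 16 * (κ * Q.Δmax + Jmax) * (κ * Q.Δmax)) ≤ 16 * E := by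
      have p1 : 0 ≤ κ * rmax := by positivity
      have p2 : 0 ≤ Jmax * κ * Q.Δmax := by positivity
      have p3 : (κ * Q.Δmax + Jmax) * (κ * Q.Δmax) ≤ (κ * Q.Δmax + Jmax) ^ 2 := by
        rw [sq]; gcongr; linarith
      rw [hEeq]
      linarith
    rw [e1, norm_smul, norm_neg, Real.norm_two]
    calc 2 * ‖ContinuousLinearMap.adjoint (M.Jk - fderiv ℝ r x) (r x)
          + ContinuousLinearMap.adjoint M.Jk (M.rk - r x)‖
        ≤ 2 * (4 * κ * Δ * rmax + 16 * (κ * Q.Δmax + Jmax) * (κ * Q.Δmax) * Δ) := by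
          gcongr
          exact norm_add_le_of_le n1 (n2.trans n3)
      _ = 2 * (4 * κ * rmax + 16 * (κ * Q.Δmax + Jmax) * (κ * Q.Δmax)) * Δ := by ring
      _ ≤ 16 * E * Δ := by gcongr
  have hE0 : 0 ≤ E := by rw [hEeq]; positivity
  constructor
  · refine hgrad.trans ?_
    gcongr
    norm_num
  · intro s hs
    have hxs : x + s ∈ region Q S := hball (by
      rw [mem_closedBall_iff_norm, add_sub_cancel_left]
      exact hs)
    have t1 := h.objective_taylor_le hn hxr hxs
    rw [add_sub_cancel_left] at t1
    have t1' : 2 * G * ‖s‖ ^ 2 ≤ 2 * E * Δ ^ 2 := by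
      have : G ≤ E := by
        rw [hEeq]
        have : 0 ≤ 2 * Jmax * κ * Q.Δmax + 2 * κ * rmax + 2 * (κ * Q.Δmax + Jmax) ^ 2 := by
          positivity
        linarith
      gcongr
    have t2 : |⟪gradient (objective r) x - M.grad, s⟫_ℝ| ≤ 16 * E * Δ ^ 2 := by
      refine (abs_real_inner_le_norm _ _).trans ?_
      calc _ ≤ 16 * E * Δ * Δ := by gcongr
        _ = _ := by ring
    have t3 : ‖M.Jk s‖ ^ 2 ≤ 8 * E * Δ ^ 2 := by
      have hle : ‖M.Jk s‖ ≤ 4 * (κ * Q.Δmax + Jmax) * Δ :=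
        (M.Jk.le_opNorm s).trans (mul_le_mul hJn hs (norm_nonneg _) (by positivity))
      calc ‖M.Jk s‖ ^ 2 ≤ (4 * (κ * Q.Δmax + Jmax) * Δ) ^ 2 := by gcongr
        _ = 8 * (2 * (κ * Q.Δmax + Jmax) ^ 2) * Δ ^ 2 := by ring
        _ ≤ 8 * E * Δ ^ 2 := by
          have : 2 * (κ * Q.Δmax + Jmax) ^ 2 ≤ E := by
            rw [hEeq]
            have : 0 ≤ G + 2 * Jmax * κ * Q.Δmax + 2 * κ * rmax := by positivity
            linarith
          gcongr
    -- The model curvature `‖Jk s‖²` counts as an error of order `Δ²`. The three terms contribute `2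
    -- + 16 + 8 = 26`.
    have e2 : objective r x - objective r (x + s) - (M.val 0 - M.val s) =
        -(objective r (x + s) - objective r x - ⟪gradient (objective r) x, s⟫_ℝ)
          - ⟪gradient (objective r) x - M.grad, s⟫_ℝ + ‖M.Jk s‖ ^ 2 := by
      rw [model_decrease_eq, inner_sub_left]
      ring
    have hfin : E * Δ ^ 2 ≤ kappaD p C LJ rmax Jmax Q.Δmax * Δ ^ 2 := by gcongr
    have h3 : 0 ≤ ‖M.Jk s‖ ^ 2 := sq_nonneg _
    rw [e2]
    rw [abs_le] at t1 t2 ⊢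
    constructor <;> linarith [t1.1, t1.2, t2.1, t2.2]

end Accuracy

/-! ### Progress of a single iteration -/

section Progress

variable {n m p : ℕ} {P : Params} {Q : MoreParams P} {r : Vec n → Vec m}

lemma Params.c1_pos (P : Params) : 0 < P.c1 := by linarith [P.c1_ge]

lemma Params.η1_lt_one (P : Params) : P.η1 < 1 := P.η1_le.trans_lt P.η2_lt

lemma Params.α1_lt_one (P : Params) : P.α1 < 1 := P.α1_lt.trans P.α2_lt

lemma MoreParams.γS_lt_c1 (Q : MoreParams P) : Q.γS < P.c1 := by
  have hc := P.c1_pos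
  have h1 : (1 : ℝ) ≤ Real.sqrt (1 + 2 * P.c1) := Real.one_le_sqrt.2 (by linarith)
  refine Q.γS_lt.trans_le ?_
  rw [div_le_iff₀ (by linarith)]
  nlinarith

/-- The contraction factor of the trust region radius in iterations that make no progress. -/
def Params.contraction (P : Params) : ℝ := max (max P.α2 P.γdec) (max P.ωS P.ωC)

lemma Params.contraction_pos (P : Params) : 0 < P.contraction :=
  P.γdec_pos.trans_le ((le_max_right _ _).trans (le_max_left _ _))

lemma Params.contraction_lt_one (P : Params) : P.contraction < 1 :=
  max_lt (max_lt P.α2_lt P.γdec_lt) (max_lt P.ωS_lt P.ωC_lt)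

lemma Params.α2_le_contraction (P : Params) : P.α2 ≤ P.contraction :=
  (le_max_left _ _).trans (le_max_left _ _)

lemma Params.γdec_le_contraction (P : Params) : P.γdec ≤ P.contraction :=
  (le_max_right _ _).trans (le_max_left _ _)

lemma Params.ωS_le_contraction (P : Params) : P.ωS ≤ P.contraction :=
  (le_max_left _ _).trans (le_max_right _ _)

lemma Params.ωC_le_contraction (P : Params) : P.ωC ≤ P.contraction :=
  (le_max_right _ _).trans (le_max_right _ _)

/-- The model is fully linear in `B(x, Δ)` with constant `κ`. -/
def IsAccurate (r : Vec n → Vec m) (x : Vec n) (M : Model n m) (Δ κ : ℝ) : Prop :=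
  ‖gradient (objective r) x - M.grad‖ ≤ κ * Δ ∧
    ∀ s, ‖s‖ ≤ Δ → |objective r x - objective r (x + s) - (M.val 0 - M.val s)| ≤ κ * Δ ^ 2

/-- `e` is a lower bound for the gradients of accepted models, `δ₁` for the radii of unsuccessful
iterations with a poised set, and `δ` for all radii, as long as `‖∇f‖ ≥ ε`. -/
structure Thresholds (P : Params) (κ κH ε e δ₁ δ : ℝ) : Prop where
  κ_pos : 0 < κ
  κH_ge : 1 ≤ κH
  e_pos : 0 < e
  δ₁_pos : 0 < δ₁
  δ_pos : 0 < δ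
  e_le : e * (1 + κ * P.μ) ≤ ε
  δ₁_le : 2 * κ * δ₁ ≤ P.c1 * (1 - P.η1) * ε
  δ₁_le_hess : 2 * κH * δ₁ ≤ ε
  δ_le_dec : δ ≤ P.α1 * (P.γdec * δ₁)
  δ_le_step : δ ≤ P.α1 * (P.c1 * δ₁)
  δ_le_grad : δ ≤ P.α1 * (P.c1 * (e / κH))
  δ_le_crit : δ * (1 + κ * P.μ) ≤ P.ωC * (P.μ * ε)

/-- Bounds on the radii that hold as long as `‖∇f‖ ≥ ε`. -/
structure RadiusBounds (Q : MoreParams P) (δ : ℝ) (S : State n p) : Prop where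
  le_ρ : δ ≤ S.ρ
  le_Δ : δ ≤ S.Δ
  Δ_le : S.Δ ≤ Q.Δmax
  ρ_le : S.inCrit = false → S.ρ ≤ S.Δ

open Classical in
/-- The stage of the model improvement process: a state in the criticality phase is at stage `2`, a
state with a poised interpolation set at stage `1`, and any other state at stage `0`. -/
def stage (Q : MoreParams P) (S : State n p) : ℝ :=
  if S.inCrit = true then 2 else if IsPoised Q.Λ S.x S.Δ S.Y then 1 else 0

lemma stage_nonneg (Q : MoreParams P) (S : State n p) : 0 ≤ stage Q S := by
  unfold stage; split_ifs <;> norm_num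

lemma stage_le_two (Q : MoreParams P) (S : State n p) : stage Q S ≤ 2 := by
  unfold stage; split_ifs <;> norm_num

/-- The possible outcomes of an iteration: the objective decreases by `d`, the radius shrinks, or
the stage advances. -/
def MakesProgress (Q : MoreParams P) (r : Vec n → Vec m) (d : ℝ) (S S' : State n p) : Prop :=
  (objective r S'.x ≤ objective r S.x - d ∧ S'.Δ ≤ P.γincBar * S.Δ) ∨
  (S'.x = S.x ∧ S'.Δ ≤ P.contraction * S.Δ) ∨
  (S'.x = S.x ∧ S'.Δ ≤ S.Δ ∧ stage Q S + 1 ≤ stage Q S')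

/-- The Cauchy decrease condition with `‖H‖` replaced by its bound. -/
lemma cauchy_decrease_of_hess_le {M : Model n m} {s : Vec n} {Δ κH : ℝ} (hκH : 1 ≤ κH)
    (hH : ‖M.hess‖ ≤ κH)
    (h : P.c1 * ‖M.grad‖ * min Δ (‖M.grad‖ / max ‖M.hess‖ 1) ≤ M.val 0 - M.val s) :
    P.c1 * ‖M.grad‖ * min Δ (‖M.grad‖ / κH) ≤ M.val 0 - M.val s := by
  refine le_trans ?_ h
  have := P.c1_pos
  have : 0 < max ‖M.hess‖ 1 := lt_max_of_lt_right one_pos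
  gcongr
  exact max_le hH hκH

/-- The Gauss–Newton Hessian is positive semidefinite, so the model cannot drop by more than `‖g‖
‖s‖`; comparison with the Cauchy decrease cancels `‖g‖`. -/
lemma step_norm_ge {M : Model n m} {s : Vec n} {Δ κH : ℝ} (hg : 0 < ‖M.grad‖)
    (h : P.c1 * ‖M.grad‖ * min Δ (‖M.grad‖ / κH) ≤ M.val 0 - M.val s) :
    P.c1 * min Δ (‖M.grad‖ / κH) ≤ ‖s‖ := by
  refine le_of_mul_le_mul_left ?_ hg
  have := model_decrease_le M s
  linarith

/-! ### Lower bounds for model gradients and radii -/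

namespace Thresholds

variable {κ κH ε e δ₁ δ : ℝ}

lemma κH_pos (T : Thresholds P κ κH ε e δ₁ δ) : 0 < κH := one_pos.trans_le T.κH_ge

lemma δ_le_grad_div (T : Thresholds P κ κH ε e δ₁ δ) : δ ≤ e / κH := by
  have h0 : 0 < e / κH := div_pos T.e_pos T.κH_pos
  refine T.δ_le_grad.trans ?_
  calc P.α1 * (P.c1 * (e / κH)) ≤ 1 * (1 * (e / κH)) := by
        gcongr
        · exact mul_nonneg P.c1_pos.le h0.le
        · exact P.α1_lt_one.le
        · exact P.c1_le
    _ = e / κH := by ring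

/-- Outside the criticality phase this is the test against `εC`. Inside it, `Δ ≤ μ‖g‖` and accuracy
give `ε ≤ (1 + κμ)‖g‖`. -/
lemma le_grad_of_accepted (T : Thresholds P κ κH ε e δ₁ δ) {S : State n p}
    {R : Record n m p} (hεC : e ≤ Q.εC) (hε : ε ≤ ‖gradient (objective r) S.x‖)
    (hacc : S.inCrit = true → ‖gradient (objective r) S.x - R.model.grad‖ ≤ κ * S.Δ)
    (h : Accepted Q S R) : e ≤ ‖R.model.grad‖ := by
  unfold Accepted at h
  split_ifs at h with hc
  · have h1 : ‖gradient (objective r) S.x‖ ≤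
        ‖gradient (objective r) S.x - R.model.grad‖ + ‖R.model.grad‖ := by
      simpa using norm_add_le (gradient (objective r) S.x - R.model.grad) R.model.grad
    have h2 := hacc hc
    have h3 := mul_le_mul_of_nonneg_left h T.κ_pos.le
    have h4 := T.e_le
    have h5 : 0 < 1 + κ * P.μ := by have := T.κ_pos; have := P.μ_pos; positivity
    refine le_of_mul_le_mul_right ?_ h5
    linarith
  · exact hεC.trans h.le

/-- Since `γS < c1`, a safety step makes `min Δ (‖g‖ / κH)` smaller than `ρ ≤ Δ`, so the minimum
must be `‖g‖ / κH`. -/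
lemma le_lowerRadius_of_safety (T : Thresholds P κ κH ε e δ₁ δ) {M : Model n m} {s : Vec n}
    {Δ ρ : ℝ} (hρ : 0 < ρ) (hρΔ : ρ ≤ Δ) (he : e ≤ ‖M.grad‖)
    (hdec : P.c1 * ‖M.grad‖ * min Δ (‖M.grad‖ / κH) ≤ M.val 0 - M.val s)
    (hs : ‖s‖ < Q.γS * ρ) : e / κH ≤ ρ := by
  have h1 := step_norm_ge (T.e_pos.trans_le he) hdec
  have h2 := Q.γS_lt_c1
  have h3 : P.c1 * min Δ (‖M.grad‖ / κH) < P.c1 * ρ :=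
    (h1.trans_lt hs).trans (mul_lt_mul_of_pos_right h2 hρ)
  have h4 := lt_of_mul_lt_mul_left h3 P.c1_pos.le
  rcases min_lt_iff.1 h4 with h5 | h5
  · linarith
  · exact (div_le_div_of_nonneg_right he T.κH_pos.le).trans h5.le

/-- An iteration with an accurate model and a small radius is successful. -/
lemma le_radius_of_unsuccessful (T : Thresholds P κ κH ε e δ₁ δ) {x : Vec n} {M : Model n m}
    {s : Vec n} {Δ : ℝ} (hΔ : 0 < Δ) (hε : ε ≤ ‖gradient (objective r) x‖)
    (hacc : IsAccurate r x M Δ κ) (hs : ‖s‖ ≤ Δ)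
    (hdec : P.c1 * ‖M.grad‖ * min Δ (‖M.grad‖ / κH) ≤ M.val 0 - M.val s)
    (hq : ratio r x M s < P.η1) : δ₁ ≤ Δ := by
  by_contra! hlt
  have hκ := T.κ_pos
  have hη := P.η1_lt_one
  have hη0 := P.η1_pos
  have hc := P.c1_pos
  have hκΔ : 2 * κ * Δ ≤ P.c1 * (1 - P.η1) * ε :=
    (mul_le_mul_of_nonneg_left hlt.le (by positivity)).trans T.δ₁_le
  have hε0 : 0 < ε := by
    have := T.δ₁_le_hess
    have : 0 < 2 * κH * δ₁ := mul_pos (mul_pos two_pos T.κH_pos) T.δ₁_pos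
    linarith
  have hcη : P.c1 * (1 - P.η1) ≤ 1 := by nlinarith [P.c1_le]
  have hg : ε / 2 ≤ ‖M.grad‖ := by
    have h1 : ‖gradient (objective r) x‖ ≤ ‖gradient (objective r) x - M.grad‖ + ‖M.grad‖ := by
      simpa using norm_add_le (gradient (objective r) x - M.grad) M.grad
    have h2 := hacc.1
    nlinarith
  have hmin : min Δ (‖M.grad‖ / κH) = Δ := by
    refine min_eq_left ?_
    rw [le_div_iff₀ T.κH_pos]
    have h1 := T.δ₁_le_hess
    have h2 := mul_le_mul_of_nonneg_left hlt.le T.κH_pos.le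
    linarith
  rw [hmin] at hdec
  have hdec' : P.c1 * (ε / 2) * Δ ≤ M.val 0 - M.val s := by
    refine le_trans ?_ hdec
    gcongr
  have hpos : 0 < M.val 0 - M.val s := lt_of_lt_of_le (by positivity) hdec'
  rw [ratio, div_lt_iff₀ hpos] at hq
  -- Below `δ₁` the accuracy error is at most `1 - η1` times the predicted decrease, which forces
  -- the ratio up to `η1`.
  have h3 := (abs_le.1 (hacc.2 s hs)).1
  have h4 : κ * Δ ^ 2 ≤ (1 - P.η1) * (P.c1 * (ε / 2) * Δ) := by nlinarith
  have h5 := mul_le_mul_of_nonneg_left hdec' (by linarith : 0 ≤ 1 - P.η1)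
  linarith

/-- Rejection means `‖g‖ < Δ / μ`, so accuracy gives `ε ≤ (κ + 1/μ) Δ`: the criticality loop stops
before the radius is too small. -/
lemma le_radius_of_not_accepted (T : Thresholds P κ κH ε e δ₁ δ) {x : Vec n}
    {M : Model n m} {Δ : ℝ} (hε : ε ≤ ‖gradient (objective r) x‖)
    (hacc : ‖gradient (objective r) x - M.grad‖ ≤ κ * Δ)
    (h : P.μ * ‖M.grad‖ < Δ) : δ ≤ P.ωC * Δ := by
  have hκ := T.κ_pos
  have hμ := P.μ_pos
  have hω := P.ωC_pos
  have h1 : ‖gradient (objective r) x‖ ≤ ‖gradient (objective r) x - M.grad‖ + ‖M.grad‖ := by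
    simpa using norm_add_le (gradient (objective r) x - M.grad) M.grad
  have h5 : 0 < 1 + κ * P.μ := by positivity
  refine le_of_mul_le_mul_right (T.δ_le_crit.trans ?_) h5
  have h2 : P.μ * ε ≤ P.μ * (κ * Δ + ‖M.grad‖) := by gcongr; linarith
  have h3 : P.μ * ε ≤ Δ * (1 + κ * P.μ) := by linarith
  have := mul_le_mul_of_nonneg_left h3 hω.le
  linarith

end Thresholds

lemma radiusUpdate_of_le {Δ ρ σ q : ℝ} (hq : P.η1 ≤ q) (hΔ : 0 < Δ) (hρ : ρ ≤ Δ) (hσ : σ ≤ Δ)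
    (hmax : Δ ≤ Q.Δmax) :
    ρ ≤ radiusUpdate Q Δ ρ σ q ∧ radiusUpdate Q Δ ρ σ q ≤ Q.Δmax ∧
      radiusUpdate Q Δ ρ σ q ≤ P.γincBar * Δ := by
  have hγ := Q.γinc_gt
  have hγ' := Q.γinc_le
  have hb : 0 ≤ P.γincBar := by linarith
  have h1 : Δ ≤ Q.γinc * Δ := le_mul_of_one_le_left hΔ.le hγ.le
  have h2 : Q.γinc * Δ ≤ P.γincBar * Δ := mul_le_mul_of_nonneg_right hγ' hΔ.le
  have h3 : P.γdec * Δ ≤ Δ := mul_le_of_le_one_left hΔ.le P.γdec_lt.le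
  unfold radiusUpdate
  split_ifs
  · refine ⟨le_min (hρ.trans (h1.trans (le_max_left _ _))) (hρ.trans hmax), min_le_right _ _,
      (min_le_left _ _).trans (max_le h2 (mul_le_mul_of_nonneg_left hσ hb))⟩
  · have h4 : max (max (P.γdec * Δ) σ) ρ ≤ Δ := max_le (max_le h3 hσ) hρ
    exact ⟨le_max_right _ _, h4.trans hmax, h4.trans (h1.trans h2)⟩

lemma radiusUpdate_of_lt {Δ ρ σ q : ℝ} (hq : q < P.η1) :
    radiusUpdate Q Δ ρ σ q = max (min (P.γdec * Δ) σ) ρ := by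
  unfold radiusUpdate
  rw [if_neg (by linarith [P.η1_le]), if_neg (by linarith)]

/-- If the radius was tentatively reduced to `max a ρ`, it shrinks. -/
lemma ReduceIfEqual.bounds {δ Δ ρ a : ℝ} {S' : State n p}
    (h : ReduceIfEqual P ρ (max a ρ) S') (ha : a ≤ P.contraction * Δ) (hΔ : 0 ≤ Δ)
    (hmax : Δ ≤ Q.Δmax) (hρ : 0 ≤ ρ) (hρΔ : ρ ≤ Δ) (hδ : δ ≤ ρ)
    (hred : a ≤ ρ → δ ≤ P.α1 * ρ) :
    RadiusBounds Q δ S' ∧ S'.Δ ≤ P.contraction * Δ := by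
  have hβ := P.contraction_lt_one
  have hcΔ : P.contraction * Δ ≤ Δ := mul_le_of_le_one_left hΔ hβ.le
  -- If the tentative radius hits `ρ`, the factor `α2` still makes the radius shrink, even when `ρ =
  -- Δ`.
  rcases le_or_gt a ρ with har | har
  · obtain ⟨h1, h2⟩ := h.1 (max_eq_right har)
    have h3 := hred har
    have h4 : P.α1 * ρ ≤ P.α2 * ρ := mul_le_mul_of_nonneg_right P.α1_lt.le hρ
    have h5 : P.α2 * ρ ≤ P.contraction * Δ :=
      mul_le_mul P.α2_le_contraction hρΔ hρ P.contraction_pos.le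
    refine ⟨⟨?_, ?_, ?_, fun _ => ?_⟩, ?_⟩ <;> simp only [h1, h2] <;> linarith
  · rw [max_eq_left har.le] at h
    obtain ⟨h1, h2⟩ := h.2 har.ne'
    refine ⟨⟨?_, ?_, ?_, fun _ => ?_⟩, ?_⟩ <;> simp only [h1, h2] <;> linarith

/-- Progress of an iteration whose model is accepted. -/
lemma trustRegionStep_progress {κ κH ε e δ₁ δ : ℝ} (T : Thresholds P κ κH ε e δ₁ δ)
    {S S' : State n p} {R : Record n m p}
    (hS : RadiusBounds Q δ S) (hε : ε ≤ ‖gradient (objective r) S.x‖)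
    (hcritY : S.inCrit = true → IsPoised Q.Λ S.x S.Δ R.Y)
    (hY : S.inCrit = false → R.Y = S.Y)
    (hacc : IsPoised Q.Λ S.x S.Δ R.Y → IsAccurate r S.x R.model S.Δ κ)
    (he : e ≤ ‖R.model.grad‖)
    (hdec : P.c1 * ‖R.model.grad‖ * min S.Δ (‖R.model.grad‖ / κH)
      ≤ R.model.val 0 - R.model.val R.s)
    (h : TrustRegionStep Q r S.x R S.Δ (lowerRadius S) S') :
    RadiusBounds Q δ S' ∧ MakesProgress Q r (P.η1 * (P.c1 * e * δ)) S S' := by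
  have hκH := T.κH_pos
  have hc := P.c1_pos
  have hδ0 := T.δ_pos
  have he0 := T.e_pos
  have hΔ0 : 0 < S.Δ := T.δ_pos.trans_le hS.le_Δ
  have hρΔ : lowerRadius S ≤ S.Δ := by
    unfold lowerRadius
    split_ifs with hc
    · exact min_le_right _ _
    · exact hS.ρ_le (by simpa using hc)
  have hδρ : δ ≤ lowerRadius S := by
    unfold lowerRadius
    split_ifs
    · exact le_min hS.le_ρ hS.le_Δ
    · exact hS.le_ρ
  set ρ := lowerRadius S with hρdef
  have hρ0 : 0 < ρ := T.δ_pos.trans_le hδρ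
  have hgH : e / κH ≤ ‖R.model.grad‖ / κH := div_le_div_of_nonneg_right he hκH.le
  have hγΔ : P.γdec * S.Δ ≤ P.contraction * S.Δ :=
    mul_le_mul_of_nonneg_right P.γdec_le_contraction hΔ0.le
  obtain ⟨hs, hcrit', hsafe, hsucc, himp, hunsucc⟩ := h
  rcases lt_or_ge ‖R.s‖ (Q.γS * ρ) with hsm | hlg
  · obtain ⟨hx, -, hred⟩ := hsafe hsm
    have hρe := T.le_lowerRadius_of_safety hρ0 hρΔ he hdec hsm
    rw [max_comm] at hred
    obtain ⟨hb, hshr⟩ := hred.bounds (Q := Q) (δ := δ) (Δ := S.Δ)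
      (mul_le_mul_of_nonneg_right P.ωS_le_contraction hΔ0.le) hΔ0.le hS.Δ_le hρ0.le hρΔ hδρ
      fun _ => T.δ_le_grad.trans (mul_le_mul_of_nonneg_left
        ((mul_le_of_le_one_left (by positivity) P.c1_le).trans hρe) P.α1_pos.le)
    exact ⟨hb, Or.inr (Or.inl ⟨hx, hshr⟩)⟩
  rcases le_or_gt P.η1 (ratio r S.x R.model R.s) with hq | hq
  · obtain ⟨hx, -, hρ', hΔ'⟩ := hsucc hlg hq
    obtain ⟨u1, u2, u3⟩ := radiusUpdate_of_le (Q := Q) hq hΔ0 hρΔ hs hS.Δ_le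
    refine ⟨⟨?_, ?_, ?_, fun _ => ?_⟩, Or.inl ⟨?_, ?_⟩⟩
    · rwa [hρ']
    · rw [hΔ']; exact hδρ.trans u1
    · rwa [hΔ']
    · rwa [hρ', hΔ']
    · have hdec' : P.c1 * e * δ ≤ R.model.val 0 - R.model.val R.s := by
        refine le_trans ?_ hdec
        gcongr
        exact le_min hS.le_Δ (T.δ_le_grad_div.trans hgH)
      have hpos : 0 < R.model.val 0 - R.model.val R.s := lt_of_lt_of_le (by positivity) hdec'
      rw [ratio, le_div_iff₀ hpos] at hq
      have := mul_le_mul_of_nonneg_left hdec' P.η1_pos.le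
      rw [hx]
      linarith
    · rwa [hΔ']
  by_cases hpois : IsPoised Q.Λ S.x S.Δ R.Y
  · obtain ⟨hx, -, hred⟩ := hunsucc hlg hq hpois
    rw [radiusUpdate_of_lt hq] at hred
    have hδ₁ := T.le_radius_of_unsuccessful hΔ0 hε (hacc hpois) hs hdec hq
    have hsge := step_norm_ge (T.e_pos.trans_le he) hdec
    obtain ⟨hb, hshr⟩ := hred.bounds (Q := Q) (δ := δ) (Δ := S.Δ)
      ((min_le_left _ _).trans hγΔ) hΔ0.le hS.Δ_le hρ0.le hρΔ hδρ (by
        intro hle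
        -- Here `ρ` is about to be reduced, so it bounds `min (γdec Δ) ‖s‖` from above; failure on a
        -- poised set gives `Δ ≥ δ₁`, and the Cauchy decrease bounds `‖s‖` below.
        have key : min (P.γdec * δ₁) (P.c1 * min δ₁ (e / κH)) ≤ ρ := by
          refine le_trans (min_le_min (mul_le_mul_of_nonneg_left hδ₁ P.γdec_pos.le) ?_) hle
          exact (mul_le_mul_of_nonneg_left (min_le_min hδ₁ hgH) hc.le).trans hsge
        refine le_trans ?_ (mul_le_mul_of_nonneg_left key P.α1_pos.le)
        rcases min_choice (P.γdec * δ₁) (P.c1 * min δ₁ (e / κH)) with h1 | h1 <;> rw [h1]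
        · exact T.δ_le_dec
        · rcases min_choice δ₁ (e / κH) with h2 | h2 <;> rw [h2]
          · exact T.δ_le_step
          · exact T.δ_le_grad)
    exact ⟨hb, Or.inr (Or.inl ⟨hx, hshr⟩)⟩
  · obtain ⟨hx, hgood, hρ', hΔ'⟩ := himp hlg hq hpois
    rw [radiusUpdate_of_lt hq] at hΔ' hgood
    have hle : max (min (P.γdec * S.Δ) ‖R.s‖) ρ ≤ S.Δ :=
      max_le ((min_le_right _ _).trans hs) hρΔ
    -- Sets in the criticality phase are poised, so model improvement starts at stage `0` and ends
    -- at stage `1`.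
    have hncrit : S.inCrit = false := by
      by_contra hcr
      exact hpois (hcritY (by simpa using hcr))
    refine ⟨⟨?_, ?_, ?_, fun _ => ?_⟩, Or.inr (Or.inr ⟨hx, ?_, ?_⟩)⟩
    · rwa [hρ']
    · rw [hΔ']; exact hδρ.trans (le_max_right _ _)
    · rw [hΔ']; exact hle.trans hS.Δ_le
    · rw [hρ', hΔ']; exact le_max_right _ _
    · rwa [hΔ']
    · rw [hY hncrit] at hpois
      have hpois' : IsPoised Q.Λ S'.x S'.Δ S'.Y := by rw [hx, hΔ']; exact hgood.1
      rw [stage, stage, if_neg (by simp [hncrit]), if_neg hpois, if_neg (by simp [hcrit']),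
        if_pos hpois']
      norm_num

/-- Every iteration preserves the radius bounds and makes progress, as long as `‖∇f‖ ≥ ε`. -/
lemma step_progress {κ κH ε e δ₁ δ : ℝ} (T : Thresholds P κ κH ε e δ₁ δ) (hεC : e ≤ Q.εC)
    {S S' : State n p} {R : Record n m p} (hstep : Step Q r S R S')
    (hS : RadiusBounds Q δ S) (hε : ε ≤ ‖gradient (objective r) S.x‖)
    (hacc : IsPoised Q.Λ S.x S.Δ R.Y → IsAccurate r S.x R.model S.Δ κ)
    (hdec : Accepted Q S R → P.c1 * ‖R.model.grad‖ * min S.Δ (‖R.model.grad‖ / κH)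
      ≤ R.model.val 0 - R.model.val R.s) :
    RadiusBounds Q δ S' ∧ MakesProgress Q r (P.η1 * (P.c1 * e * δ)) S S' := by
  obtain ⟨hY, hgood, -, hA, hnA⟩ := hstep
  have hcritY : S.inCrit = true → IsPoised Q.Λ S.x S.Δ R.Y := fun hc => (hgood hc).1
  by_cases h : Accepted Q S R
  · exact trustRegionStep_progress T hS hε hcritY hY hacc
      (T.le_grad_of_accepted hεC hε (fun hc => (hacc (hcritY hc)).1) h) (hdec h) (hA h)
  obtain ⟨hx, -, hρ', hcrit', hΔ'⟩ := hnA h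
  have hΔ0 : 0 < S.Δ := T.δ_pos.trans_le hS.le_Δ
  by_cases hc : S.inCrit = true
  · rw [if_pos hc] at hΔ'
    rw [Accepted, if_pos hc, not_le] at h
    have h1 := T.le_radius_of_not_accepted hε (hacc (hcritY hc)).1 h
    have h2 : P.ωC * S.Δ ≤ P.contraction * S.Δ :=
      mul_le_mul_of_nonneg_right P.ωC_le_contraction hΔ0.le
    have h3 : P.ωC * S.Δ ≤ S.Δ := mul_le_of_le_one_left hΔ0.le P.ωC_lt.le
    refine ⟨⟨?_, ?_, ?_, fun hf => ?_⟩, Or.inr (Or.inl ⟨hx, ?_⟩)⟩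
    · rw [hρ']; exact hS.le_ρ
    · rwa [hΔ']
    · rw [hΔ']; exact h3.trans hS.Δ_le
    · rw [hcrit'] at hf; cases hf
    · rwa [hΔ']
  · rw [if_neg hc] at hΔ'
    refine ⟨⟨?_, ?_, ?_, fun hf => ?_⟩, Or.inr (Or.inr ⟨hx, hΔ'.le, ?_⟩)⟩
    · rw [hρ']; exact hS.le_ρ
    · rw [hΔ']; exact hS.le_Δ
    · rw [hΔ']; exact hS.Δ_le
    · rw [hcrit'] at hf; cases hf
    · rw [stage, stage, if_neg hc, if_pos hcrit']
      split_ifs <;> norm_num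

end Progress

/-! ### Counting iterations -/

section Complexity

variable {n m p : ℕ} {P : Params} {Q : MoreParams P} {r : Vec n → Vec m}

/-- With `e = a ε/κ`, `δ₁ = w ε/(κ κH)` and `δ = b ε/(κ κH)`, the bound `κ ≥ κ0` reduces the
conditions to finitely many upper bounds on `a`, `w`, `b` that are free of `κ`, `κH`, `ε`. In
particular `1 + κμ ≤ κ (1/κ0 + μ)`. -/
lemma exists_thresholds (P : Params) {c3 κ0 : ℝ} (hc3 : 0 < c3) (hκ0 : 0 < κ0) :
    ∃ a b : ℝ, 0 < a ∧ 0 < b ∧ ∀ κ κH ε : ℝ, κ0 ≤ κ → 1 ≤ κH → 0 < ε → ε ≤ 1 →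
      (∃ δ₁, Thresholds P κ κH ε (a * (ε / κ)) δ₁ (b * (ε / (κ * κH)))) ∧
      a * (ε / κ) ≤ c3 * ε ∧ b * (ε / (κ * κH)) ≤ P.Δ0 := by
  have hμ := P.μ_pos
  have hc := P.c1_pos
  have hα := P.α1_pos
  have hγ := P.γdec_pos
  have hω := P.ωC_pos
  have hη : 0 < 1 - P.η1 := sub_pos.2 P.η1_lt_one
  have hΔ := P.Δ0_pos
  have hE : 0 < 1 / κ0 + P.μ := by positivity
  obtain ⟨a, ha0, ha1, ha2⟩ : ∃ a, 0 < a ∧ a ≤ c3 * κ0 ∧ a ≤ 1 / (1 / κ0 + P.μ) :=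
    ⟨min (c3 * κ0) (1 / (1 / κ0 + P.μ)), lt_min (by positivity) (by positivity),
      min_le_left _ _, min_le_right _ _⟩
  obtain ⟨w, hw0, hw1, hw2⟩ : ∃ w, 0 < w ∧ 2 * w ≤ κ0 ∧ 2 * w ≤ P.c1 * (1 - P.η1) :=
    ⟨min (κ0 / 2) (P.c1 * (1 - P.η1) / 2), lt_min (by positivity) (by positivity),
      by linarith [min_le_left (κ0 / 2) (P.c1 * (1 - P.η1) / 2)],
      by linarith [min_le_right (κ0 / 2) (P.c1 * (1 - P.η1) / 2)]⟩
  obtain ⟨b, hb0, hb1, hb2, hb3, hb4, hb5⟩ : ∃ b, 0 < b ∧ b ≤ κ0 * P.Δ0 ∧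
      b ≤ P.α1 * (P.γdec * w) ∧ b ≤ P.α1 * (P.c1 * w) ∧ b ≤ P.α1 * (P.c1 * a) ∧
      b ≤ P.ωC * P.μ / (1 / κ0 + P.μ) := by
    refine ⟨min (κ0 * P.Δ0) (min (P.α1 * (P.γdec * w)) (min (P.α1 * (P.c1 * w))
      (min (P.α1 * (P.c1 * a)) (P.ωC * P.μ / (1 / κ0 + P.μ))))), ?_, ?_, ?_, ?_, ?_, ?_⟩
    · refine lt_min ?_ (lt_min ?_ (lt_min ?_ (lt_min ?_ ?_))) <;> positivity
    · exact min_le_left _ _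
    · exact (min_le_right _ _).trans (min_le_left _ _)
    · exact (min_le_right _ _).trans ((min_le_right _ _).trans (min_le_left _ _))
    · exact (min_le_right _ _).trans ((min_le_right _ _).trans ((min_le_right _ _).trans
        (min_le_left _ _)))
    · exact (min_le_right _ _).trans ((min_le_right _ _).trans ((min_le_right _ _).trans
        (min_le_right _ _)))
  refine ⟨a, b, ha0, hb0, fun κ κH ε hκ hκH hε hε1 => ?_⟩
  have hκp : 0 < κ := hκ0.trans_le hκ
  have hκHp : 0 < κH := one_pos.trans_le hκH
  obtain ⟨t, ht⟩ : ∃ t, t = ε / (κ * κH) := ⟨_, rfl⟩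
  have ht0 : 0 < t := by rw [ht]; positivity
  have hinv : 1 / κ ≤ 1 / κ0 := one_div_le_one_div_of_le hκ0 hκ
  have hεκ : ε / κ ≤ ε / κ0 := div_le_div_of_nonneg_left hε.le hκ0 hκ
  have hκt : κ * t ≤ ε := by
    rw [ht, ← div_div, mul_div_assoc', mul_div_cancel₀ _ hκp.ne']
    exact div_le_self hε.le hκH
  have hκHt : κH * t = ε / κ := by rw [ht]; field_simp
  have hκ0t : κ0 * t ≤ ε := (mul_le_mul_of_nonneg_right hκ ht0.le).trans hκt
  have hgrad : a * (ε / κ) / κH = a * t := by rw [ht]; field_simp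
  rw [← ht]
  refine ⟨⟨w * t, ⟨hκp, hκH, by positivity, by positivity, by positivity, ?_, ?_, ?_, ?_, ?_, ?_,
    ?_⟩⟩, ?_, ?_⟩
  · rw [le_div_iff₀ hE] at ha2
    calc a * (ε / κ) * (1 + κ * P.μ) = a * (1 / κ + P.μ) * ε := by field_simp
      _ ≤ a * (1 / κ0 + P.μ) * ε := by gcongr
      _ ≤ ε := mul_le_of_le_one_left hε.le ha2
  · calc 2 * κ * (w * t) = (2 * w) * (κ * t) := by ring
      _ ≤ P.c1 * (1 - P.η1) * ε := by gcongr
  · calc 2 * κH * (w * t) = 2 * w * (ε / κ) := by rw [← hκHt]; ring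
      _ ≤ κ0 * (ε / κ0) := by gcongr
      _ = ε := mul_div_cancel₀ _ hκ0.ne'
  · calc b * t ≤ P.α1 * (P.γdec * w) * t := by gcongr
      _ = _ := by ring
  · calc b * t ≤ P.α1 * (P.c1 * w) * t := by gcongr
      _ = _ := by ring
  · rw [hgrad]
    calc b * t ≤ P.α1 * (P.c1 * a) * t := by gcongr
      _ = _ := by ring
  · rw [le_div_iff₀ hE] at hb5
    calc b * t * (1 + κ * P.μ) = b * (1 / κ + P.μ) * (κ * t) := by field_simp
      _ ≤ b * (1 / κ0 + P.μ) * ε := by gcongr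
      _ ≤ P.ωC * P.μ * ε := by gcongr
      _ = _ := by ring
  · calc a * (ε / κ) ≤ (c3 * κ0) * (ε / κ0) := by gcongr
      _ = c3 * ε := by field_simp
  · calc b * t ≤ κ0 * P.Δ0 * t := by gcongr
      _ = P.Δ0 * (κ0 * t) := by ring
      _ ≤ P.Δ0 * 1 := by gcongr; linarith
      _ = P.Δ0 := mul_one _

/-- A potential that decreases by `1` in every iteration that makes progress. -/
def potential (Q : MoreParams P) (r : Vec n → Vec m) (d : ℝ) (S : State n p) : ℝ :=
  3 / -Real.log P.contraction * Real.log S.Δ - stage Q S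
    + (3 / -Real.log P.contraction * Real.log P.γincBar + 3) / d * objective r S.x

lemma Params.neg_log_contraction_pos (P : Params) : 0 < -Real.log P.contraction :=
  neg_pos.2 (Real.log_neg P.contraction_pos P.contraction_lt_one)

lemma Params.log_γincBar_pos (P : Params) : 0 < Real.log P.γincBar := Real.log_pos P.γincBar_gt

lemma MakesProgress.potential_le {d : ℝ} (hd : 0 < d) {S S' : State n p} (hΔ : 0 < S.Δ)
    (hΔ' : 0 < S'.Δ) (h : MakesProgress Q r d S S') :
    potential Q r d S' ≤ potential Q r d S - 1 := by
  have hL := P.neg_log_contraction_pos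
  have hG := P.log_γincBar_pos
  have hβ := P.contraction_pos
  have hγ : 0 < P.γincBar := one_pos.trans P.γincBar_gt
  unfold potential
  set L := -Real.log P.contraction with hLdef
  have h3L : 0 < 3 / L := by positivity
  have hs0 := stage_nonneg Q S
  have hs2 := stage_le_two Q S
  have hs0' := stage_nonneg Q S'
  set A := 3 / L * Real.log P.γincBar + 3 with hA
  have hA0 : 0 < A := by positivity
  rcases h with ⟨hf, hr⟩ | ⟨hx, hr⟩ | ⟨hx, hr, hst⟩
  -- The objective term pays `A`: the growth of the logarithmic term, at most `2` for a lost stage,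
  -- and the required `1`.
  · have h1 : Real.log S'.Δ ≤ Real.log P.γincBar + Real.log S.Δ := by
      rw [← Real.log_mul hγ.ne' hΔ.ne']
      exact Real.log_le_log hΔ' hr
    have h2 := mul_le_mul_of_nonneg_left h1 h3L.le
    have h3 := mul_le_mul_of_nonneg_left hf (div_pos hA0 hd).le
    have h4 : A / d * (objective r S.x - d) = A / d * objective r S.x - A := by
      field_simp
    rw [h4] at h3
    linarith
  -- The weight `3 / L` makes a contraction worth `3`, at most `2` of which is lost through the
  -- stage.
  · have h1 : Real.log S'.Δ ≤ -L + Real.log S.Δ := by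
      rw [hLdef, neg_neg, ← Real.log_mul hβ.ne' hΔ.ne']
      exact Real.log_le_log hΔ' hr
    have h2 := mul_le_mul_of_nonneg_left h1 h3L.le
    have h3 : 3 / L * (-L + Real.log S.Δ) = -3 + 3 / L * Real.log S.Δ := by
      field_simp
    rw [h3] at h2
    rw [hx]
    linarith
  · have h2 := mul_le_mul_of_nonneg_left (Real.log_le_log hΔ' hr) h3L.le
    rw [hx]
    linarith

lemma objective_nonneg (r : Vec n → Vec m) (x : Vec n) : 0 ≤ objective r x := sq_nonneg _

/-- An upper bound for the number of iterations that make progress. -/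
lemma iterations_le {S : ℕ → State n p} {d δ : ℝ} (hd : 0 < d) (hδ : 0 < δ) {N : ℕ}
    (h0 : RadiusBounds Q δ (S 0))
    (h : ∀ j < N, RadiusBounds Q δ (S j) →
      RadiusBounds Q δ (S (j + 1)) ∧ MakesProgress Q r d (S j) (S (j + 1))) :
    (N : ℝ) ≤ 3 / -Real.log P.contraction * ((S 0).Δ / δ) + 2
      + (3 / -Real.log P.contraction * Real.log P.γincBar + 3) / d * objective r (S 0).x := by
  have hL := P.neg_log_contraction_pos
  have hG := P.log_γincBar_pos
  have main : ∀ M ≤ N, RadiusBounds Q δ (S M) ∧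
      potential Q r d (S M) ≤ potential Q r d (S 0) - M := by
    intro M
    induction M with
    | zero => exact fun _ => ⟨h0, by simp⟩
    | succ M ih =>
      intro hM
      obtain ⟨hb, hpot⟩ := ih (by omega)
      obtain ⟨hb', hprog⟩ := h M (by omega) hb
      refine ⟨hb', ?_⟩
      have := hprog.potential_le hd (hδ.trans_le hb.le_Δ) (hδ.trans_le hb'.le_Δ)
      push_cast
      linarith
  obtain ⟨hb, hpot⟩ := main N le_rfl
  -- The crude bound `log t ≤ t` suffices: `1/δ` is of order `κ κH / ε`, which `κH κ² ε⁻²`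
  -- dominates.
  have hlog : Real.log (S 0).Δ - Real.log (S N).Δ ≤ (S 0).Δ / δ := by
    have h1 := Real.log_le_log hδ hb.le_Δ
    have h2 : Real.log ((S 0).Δ / δ) ≤ (S 0).Δ / δ :=
      Real.log_le_self (div_pos (hδ.trans_le h0.le_Δ) hδ).le
    rw [Real.log_div (hδ.trans_le h0.le_Δ).ne' hδ.ne'] at h2
    linarith
  have hlog' := mul_le_mul_of_nonneg_left hlog (div_pos three_pos hL).le
  have hf : 0 ≤ (3 / -Real.log P.contraction * Real.log P.γincBar + 3) / d *
      objective r (S N).x := mul_nonneg (by positivity) (objective_nonneg r _)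
  have hs0 := stage_nonneg Q (S 0)
  have hs2 := stage_le_two Q (S N)
  unfold potential at hpot
  linarith

/-! ### Counting evaluations, and the iteration bound -/

lemma card_newPoints_le (Q : MoreParams P) (S : State n p) (R : Record n m p) (S' : State n p) :
    (newPoints Q S R S').card ≤ 2 * p + 3 := by
  classical
  have himg : ∀ Y Z : InterpSet n p,
      (Finset.univ.image Y \ Finset.univ.image Z).card ≤ p + 1 := fun Y Z =>
    (Finset.card_le_card Finset.sdiff_subset).trans (Finset.card_image_le.trans (by simp))
  unfold newPoints
  refine (Finset.card_union_le _ _).trans ?_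
  refine (Nat.add_le_add (Finset.card_union_le _ _) le_rfl).trans ?_
  have h1 := himg R.Y S.Y
  have h2 := himg S'.Y R.Y
  have h3 : (if Accepted Q S R ∧ Q.γS * lowerRadius S ≤ ‖R.s‖ then {S.x + R.s} else ∅ :
      Finset (Vec n)).card ≤ 1 := by
    split_ifs <;> simp
  exact (Nat.add_le_add (Nat.add_le_add h1 h3) h2).trans (by omega)

lemma evaluations_le (Q : MoreParams P) (S : ℕ → State n p) (R : ℕ → Record n m p) (N : ℕ) :
    evaluations Q S R N ≤ (p + 1) + N * (2 * p + 3) := by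
  unfold evaluations
  refine Nat.add_le_add le_rfl ((Finset.sum_le_card_nsmul _ _ (2 * p + 3)
    fun j _ => card_newPoints_le Q _ _ _).trans ?_)
  simp

/-- An iteration bound in terms of `κ = 26 κ_d`. -/
lemma exists_iteration_bound (P : Params) (F : ℝ) {c3 κ0 : ℝ} (hc3 : 0 < c3) (hκ0 : 0 < κ0) :
    ∃ K : ℝ, 0 < K ∧
      ∀ (Q : MoreParams P) (n m p : ℕ), 1 ≤ n → n ≤ p →
      ∀ (r : Vec n → Vec m) (x0 : Vec n) (S : ℕ → State n p) (R : ℕ → Record n m p)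
        (LJ rmax Jmax κH C ε : ℝ),
        IsExecution Q r x0 S R → SmoothnessAssumption Q r S LJ rmax Jmax →
        CauchyDecrease Q S R → 1 ≤ κH → BoundedHessian Q S R κH → BoundsPinv Q S R C →
        objective r x0 ≤ F → κ0 ≤ kappaD p C LJ rmax Jmax Q.Δmax →
        0 < ε → ε ≤ 1 → c3 * ε ≤ Q.εC →
        ∀ N : ℕ, (∀ j < N, ε ≤ ‖gradient (objective r) (S j).x‖) →
          (N : ℝ) ≤ K * (κH * (26 * kappaD p C LJ rmax Jmax Q.Δmax) ^ 2 * ε⁻¹ ^ 2) := by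
  obtain ⟨a, b, ha, hb, hT⟩ := exists_thresholds P (κ0 := 26 * κ0) hc3 (by positivity)
  have hL := P.neg_log_contraction_pos
  have hG := P.log_γincBar_pos
  have hΔ0 := P.Δ0_pos
  have hη := P.η1_pos
  have hc := P.c1_pos
  set A := 3 / -Real.log P.contraction * Real.log P.γincBar + 3 with hA
  have hA0 : 0 < A := by positivity
  set B := 3 / -Real.log P.contraction with hB
  have hB0 : 0 < B := by positivity
  set k0 := 26 * κ0 with hk0
  have hk0' : 0 < k0 := by positivity
  -- The summands account for the radius, the stage and the objective. `max F 0` keeps the constant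
  -- positive for every `F`.
  refine ⟨B * P.Δ0 / (b * k0) + 2 / k0 ^ 2 + A * max F 0 / (P.η1 * P.c1 * a * b), by positivity,
    fun Q n m p hn hnp r x0 S R LJ rmax Jmax κH C ε hex hsm hcd hκH hbH hbP hF hκd hε hε1 hεC
      N hN => ?_⟩
  set κ := 26 * kappaD p C LJ rmax Jmax Q.Δmax with hκ
  have hk : k0 ≤ κ := by rw [hk0, hκ]; linarith
  have hκ0 : 0 < κ := hk0'.trans_le hk
  have hκH0 : 0 < κH := one_pos.trans_le hκH
  obtain ⟨⟨δ₁, T⟩, hec3, hδΔ⟩ := hT κ κH ε hk hκH hε hε1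
  obtain ⟨δ, hδ⟩ : ∃ δ, δ = b * (ε / (κ * κH)) := ⟨_, rfl⟩
  obtain ⟨e, he⟩ : ∃ e, e = a * (ε / κ) := ⟨_, rfl⟩
  rw [← hδ, ← he] at T
  have hδ0 := T.δ_pos
  have he0 := T.e_pos
  have hb0 : RadiusBounds Q δ (S 0) := by
    refine ⟨?_, ?_, ?_, fun _ => ?_⟩
    · rw [hex.ρ_zero, hδ]; exact hδΔ
    · rw [hex.Δ_zero, hδ]; exact hδΔ
    · rw [hex.Δ_zero]; exact Q.Δmax_ge
    · rw [hex.ρ_zero, hex.Δ_zero]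
  have key := iterations_le (r := r) (d := P.η1 * (P.c1 * e * δ)) (by positivity) hδ0 hb0
    (N := N) fun j hj hbj => by
      refine step_progress T ((he.trans_le hec3).trans hεC) (hex.step j) hbj (hN j hj)
        (fun hpois => ?_) fun hacc => cauchy_decrease_of_hess_le hκH (hbH j hacc) (hcd j hacc)
      exact model_accuracy hsm hn (hn.trans hnp) (hδ0.trans_le hbj.le_Δ) hbj.Δ_le hpois
        (hbP j hpois) (hex.step j).2.2.1
  rw [hex.Δ_zero, hex.x_zero, ← hB, ← hA] at key
  set X := κH * κ ^ 2 * ε⁻¹ ^ 2 with hX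
  have hεinv : 1 ≤ ε⁻¹ := (one_le_inv₀ hε).2 hε1
  have h1 : P.Δ0 / δ ≤ P.Δ0 / (b * k0) * X := by
    have e1 : P.Δ0 / δ = P.Δ0 / (b * k0) * (κH * (k0 * κ) * (ε⁻¹ * 1)) := by
      rw [hδ]; field_simp
    rw [e1, hX, sq, sq]
    gcongr
  have h2 : 2 ≤ 2 / k0 ^ 2 * X := by
    have e2 : 2 / k0 ^ 2 * (1 * k0 ^ 2 * 1 ^ 2) = 2 := by field_simp
    refine e2.symm.trans_le ?_
    rw [hX]
    gcongr
  have h3 : A / (P.η1 * (P.c1 * e * δ)) * objective r x0 ≤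
      A * max F 0 / (P.η1 * P.c1 * a * b) * X := by
    have e3 : A * max F 0 / (P.η1 * P.c1 * a * b) * X =
        A / (P.η1 * (P.c1 * e * δ)) * max F 0 := by
      rw [hδ, he, hX]; field_simp
    rw [e3]
    gcongr
    exact hF.trans (le_max_left _ _)
  have h1' := mul_le_mul_of_nonneg_left h1 hB0.le
  calc (N : ℝ) ≤ B * (P.Δ0 / (b * k0) * X) + 2 / k0 ^ 2 * X
        + A * max F 0 / (P.η1 * P.c1 * a * b) * X := by linarith
    _ = _ := by ring

end Complexity

end DFOLS

end

/-! ### Assembly of the corollary -/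

theorem corollaryA :
    -- complexity: `K` depends only on `P`, `c3`, an upper bound for `f(x0)` and a positive lower
    -- bound for `κ_d`
    (∀ (P : DFOLS.Params) (c3 F κ0 : ℝ), 0 < c3 → 0 < κ0 →
      ∃ K : ℝ, 0 < K ∧
        ∀ (Q : DFOLS.MoreParams P) (n m p : ℕ), 1 ≤ n → n ≤ p →
        ∀ (r : DFOLS.Vec n → DFOLS.Vec m) (x0 : DFOLS.Vec n)
          (S : ℕ → DFOLS.State n p) (R : ℕ → DFOLS.Record n m p)
          (LJ rmax Jmax κH C ε : ℝ),
          DFOLS.IsExecution Q r x0 S R →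
          DFOLS.SmoothnessAssumption Q r S LJ rmax Jmax →
          DFOLS.CauchyDecrease Q S R →
          1 ≤ κH → DFOLS.BoundedHessian Q S R κH →
          0 ≤ C → DFOLS.BoundsPinv Q S R C →
          DFOLS.objective r x0 ≤ F →
          κ0 ≤ DFOLS.kappaD p C LJ rmax Jmax Q.Δmax →
          0 < ε → ε ≤ 1 → c3 * ε ≤ Q.εC →
          ∃ N : ℕ,
            (∀ j < N, ε ≤ ‖gradient (DFOLS.objective r) (S j).x‖) ∧
            ‖gradient (DFOLS.objective r) (S N).x‖ < ε ∧
            (N : ℝ) ≤ K * (κH * DFOLS.kappaD p C LJ rmax Jmax Q.Δmax ^ 2 * ε⁻¹ ^ 2) ∧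
            (DFOLS.evaluations Q S R N : ℝ) ≤
              K * (κH * DFOLS.kappaD p C LJ rmax Jmax Q.Δmax ^ 2 * p * ε⁻¹ ^ 2)) ∧
    -- `C = √(p+1) Λ` is always an admissible choice of `C` above
    (∀ (n p : ℕ) (Λ Δ : ℝ) (x : DFOLS.Vec n) (Y : DFOLS.InterpSet n p), 0 < Δ →
      DFOLS.IsPoised Λ x Δ Y → DFOLS.pinvNorm Y x Δ ≤ Real.sqrt (p + 1) * Λ) ∧
    -- `κ_d = O(p L_J²)`, where `C = O(Λ)`
    (∀ Λ C0 rmax Jmax Δmax L0 : ℝ, 1 ≤ Λ → 0 < C0 → 0 ≤ rmax → 0 ≤ Jmax → 0 < Δmax → 0 < L0 →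
      ∃ K : ℝ, 0 < K ∧ ∀ (p : ℕ) (C LJ : ℝ), 1 ≤ p → 0 ≤ C → C ≤ C0 * Λ → L0 ≤ LJ →
        DFOLS.kappaD p C LJ rmax Jmax Δmax ≤ K * (p * LJ ^ 2)) := by
  refine ⟨fun P c3 F κ0 hc3 hκ0 => ?_, fun n p Λ Δ x Y hΔ hY => DFOLS.pinvNorm_le hΔ hY,
    fun Λ C0 rmax Jmax Δmax L0 hΛ hC0 hr hJ hΔ hL0 => DFOLS.kappaD_le hΛ hC0 hr hJ hΔ hL0⟩
  obtain ⟨K, hK, hbound⟩ := DFOLS.exists_iteration_bound P F hc3 hκ0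
  -- An iteration costs at most `2p + 3 ≤ 5p` evaluations. The term `2 / κ0 ^ 2` absorbs the initial
  -- `p + 1 ≤ 2p`, because `κH κ_d² ε⁻² ≥ κ0²`.
  refine ⟨5 * (26 ^ 2 * K) + 2 / κ0 ^ 2, by positivity, fun Q n m p hn hnp r x0 S R LJ rmax Jmax
    κH C ε hex hsm hcd hκH hbH _ hbP hF hκd hε hε1 hεC => ?_⟩
  have hN := hbound Q n m p hn hnp r x0 S R LJ rmax Jmax κH C ε hex hsm hcd hκH hbH hbP hF hκd
    hε hε1 hεC
  set κ := DFOLS.kappaD p C LJ rmax Jmax Q.Δmax with hκ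
  have hκ0' : 0 < κ := hκ0.trans_le hκd
  obtain ⟨X, hX⟩ : ∃ X, X = κH * κ ^ 2 * ε⁻¹ ^ 2 := ⟨_, rfl⟩
  have hεinv : 1 ≤ ε⁻¹ := (one_le_inv₀ hε).2 hε1
  have hX1 : κ0 ^ 2 ≤ X := by
    calc κ0 ^ 2 = 1 * κ0 ^ 2 * 1 ^ 2 := by ring
      _ ≤ κH * κ ^ 2 * ε⁻¹ ^ 2 := by gcongr
      _ = X := hX.symm
  have hX0 : 0 < X := lt_of_lt_of_le (by positivity) hX1
  have hN' : ∀ N : ℕ, (∀ j < N, ε ≤ ‖gradient (DFOLS.objective r) (S j).x‖) →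
      (N : ℝ) ≤ 26 ^ 2 * K * X := fun N h => (hN N h).trans_eq (by rw [hX]; ring)
  -- Otherwise the iteration bound would hold for every `N`.
  have hex' : ∃ N, ‖gradient (DFOLS.objective r) (S N).x‖ < ε := by
    by_contra! h
    obtain ⟨N, hlt⟩ := exists_nat_gt (26 ^ 2 * K * X)
    exact absurd (hN' N fun j _ => h j) (not_le.2 hlt)
  classical
  have hmin : ∀ j < Nat.find hex', ε ≤ ‖gradient (DFOLS.objective r) (S j).x‖ :=
    fun j hj => not_lt.1 (Nat.find_min hex' hj)
  have hle := hN' _ hmin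
  have hKX : 0 < 26 ^ 2 * K * X := by positivity
  have h2X : 2 ≤ 2 / κ0 ^ 2 * X := by
    rw [div_mul_eq_mul_div, le_div_iff₀ (by positivity)]
    linarith
  refine ⟨Nat.find hex', hmin, Nat.find_spec hex', ?_, ?_⟩
  · rw [← hX]
    linarith
  · have hp : (1 : ℝ) ≤ p := by exact_mod_cast hn.trans hnp
    have hev : (DFOLS.evaluations Q S R (Nat.find hex') : ℝ) ≤
        (p + 1) + (Nat.find hex' : ℝ) * (2 * p + 3) := by
      exact_mod_cast DFOLS.evaluations_le Q S R (Nat.find hex')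
    calc (DFOLS.evaluations Q S R (Nat.find hex') : ℝ)
        ≤ (p + 1) + (Nat.find hex' : ℝ) * (2 * p + 3) := hev
      _ ≤ 2 * p + (26 ^ 2 * K * X) * (5 * p) := by gcongr <;> linarith
      _ ≤ (2 / κ0 ^ 2 * X) * p + (26 ^ 2 * K * X) * (5 * p) := by gcongr
      _ = (5 * (26 ^ 2 * K) + 2 / κ0 ^ 2) * (X * p) := by ring
      _ = _ := by rw [hX]; ring
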